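/- Let $k \neq 0$ be a semisimple commutative ring and let $\mathcal{C}$ be a discrete EI category, that is, a small (ordinary, set-enriched) category in which every endomorphism is an isomorphism. For an object $c$ write $G_c = \mathcal{C}(c,c)$, which is a group; write $c < d$ if $\mathcal{C}(c,d) \neq \emptyset$ and $c \not\cong d$. A non-invertible morphism is called unfactorisable if it is not a composition of two non-invertible morphisms. Assume that $\mathcal{C}$ has the finite factorisation property (FFP): every non-invertible morphism is a composition of finitely many unfactorisable morphisms. A left (respectively right) $\mathcal{C}$-module is a covariant (respectively contravariant) functor from $\mathcal{C}$ to the category of $k$-modules. A category of modules is called hereditary if every submodule of a projective object is projective, and a ring is called hereditary if its category of left modules is. A set is called $k^\times$-finite if its cardinality is finite and invertible in $k$. Then the category of left $\mathcal{C}$-modules and the category of right $\mathcal{C}$-modules are both hereditary if and only if the following three conditions are satisfied: 1. the group ring $kG_c$ is hereditary for every object $c$ of $\mathcal{C}$; 2. $\mathcal{C}$ has the unique factorisation property (UFP): whenever two chains $x = x_0 \xrightarrow{\alpha_1} x_1 \to \cdots \xrightarrow{\alpha_n} x_n = y$ and $x = x'_0 \xrightarrow{\alpha'_1} x'_1 \to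 \cdots \xrightarrow{\alpha'_{n'}} x'_{n'} = y$ of unfactorisable morphisms have the same composition, then $n = n'$ and there are isomorphisms $h_i \colon x_i \to x'_i$ for $0 \le i \le n$ with $h_0 = \mathrm{id}_x$, $h_n = \mathrm{id}_y$ and $\alpha'_i h_{i-1} = h_i \alpha_i$ for $1 \le i \le n$; 3. for all objects $c < d$, every biset stabiliser in $\mathcal{C}(c,d)$ is $k^\times$-finite, where the biset stabilisers in $\mathcal{C}(c,d)$ are the stabilisers of the elements $f \in \mathcal{C}(c,d)$ under the left action of $G_d \times G_c^{\mathrm{op}}$ given by $(g,h)\cdot f = g f h$. -/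

import Mathlib

open CategoryTheory

universe u

namespace EICat

/-- An EI category: every endomorphism is an isomorphism. -/
class EICategory (C : Type u) [SmallCategory C] : Prop where
  isIso_of_endo : ∀ {c : C} (f : c ⟶ c), IsIso f

/-- In an EI category the endomorphism monoid `End c` is a group, written `G_c` in the literature.
The multiplication is that of Mathlib's `End c`, i.e. `g * h` is `g ∘ h`. -/
noncomputable instance endGroup {C : Type u} [SmallCategory C] [EICategory C] (c : C) :
    Group (End c) where
  inv f := @CategoryTheory.inv C _ c c f (EICategory.isIso_of_endo f)
  inv_mul_cancel f := by
    have : @IsIso C _ c c f := EICategory.isIso_of_endo f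
    exact @IsIso.hom_inv_id C _ c c f this

section Factorisation

variable {C : Type u} [SmallCategory C]

/-- A morphism is unfactorisable if it is not invertible and is not a composition of two
non-invertible morphisms. -/
def Unfactorisable {x y : C} (f : x ⟶ y) : Prop :=
  ¬ IsIso f ∧ ¬ ∃ (z : C) (g : x ⟶ z) (h : z ⟶ y), ¬ IsIso g ∧ ¬ IsIso h ∧ g ≫ h = f

/-- Finite chains `x = x₀ ⟶ x₁ ⟶ ⋯ ⟶ xₙ = y` of unfactorisable morphisms. -/
inductive Chain (x : C) : C → Type u
  | nil : Chain x x
  | snoc {y z : C} (p : Chain x y) (α : y ⟶ z) (hα : Unfactorisable α) : Chain x z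

/-- The number of morphisms in a chain. -/
def Chain.length {x : C} : {y : C} → Chain x y → ℕ
  | _, .nil => 0
  | _, .snoc p _ _ => p.length + 1

/-- The composition of a chain. -/
def Chain.comp {x : C} : {y : C} → Chain x y → (x ⟶ y)
  | _, .nil => 𝟙 x
  | _, .snoc p α _ => p.comp ≫ α

/-- `Ladder p p' h`: the chains `p = (α₁, …, αₙ)` and `p' = (α'₁, …, α'ₙ)` with the same source
have the same length, and there are isomorphisms `hᵢ : xᵢ ≅ x'ᵢ` for `0 ≤ i ≤ n` with `h₀ = id`
and `hₙ = h` such that `α'ᵢ ∘ hᵢ₋₁ = hᵢ ∘ αᵢ` for `1 ≤ i ≤ n`. -/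
inductive Ladder {x : C} : {y y' : C} → Chain x y → Chain x y' → (y ≅ y') → Prop
  | nil : Ladder .nil .nil (Iso.refl x)
  | snoc {y y' z z' : C} {p : Chain x y} {p' : Chain x y'} {h : y ≅ y'}
      (α : y ⟶ z) (hα : Unfactorisable α) (α' : y' ⟶ z') (hα' : Unfactorisable α')
      (h' : z ≅ z') (l : Ladder p p' h) (comm : h.hom ≫ α' = α ≫ h'.hom) :
      Ladder (.snoc p α hα) (.snoc p' α' hα') h'

theorem Ladder.length_eq {x y y' : C} {p : Chain x y} {p' : Chain x y'} {h : y ≅ y'}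
    (l : Ladder p p' h) : p.length = p'.length := by
  induction l with
  | nil => rfl
  | snoc _ _ _ _ _ _ _ ih => simp only [Chain.length, ih]

variable (C)

/-- The finite factorisation property. -/
def FFP : Prop :=
  ∀ {x y : C} (f : x ⟶ y), ¬ IsIso f → ∃ p : Chain x y, p.comp = f

/-- The unique factorisation property: two chains of unfactorisable morphisms from `x` to `y`
with the same composition are related by a ladder of isomorphisms which is the identity
at both ends. -/
def UFP : Prop :=
  ∀ {x y : C} (p p' : Chain x y), p.comp = p'.comp → Ladder p p' (Iso.refl y)

end Factorisation

section Stabilisers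

variable {C : Type u} [SmallCategory C]

/-- `c < d`: there is a morphism from `c` to `d`, and `c` and `d` are not isomorphic. -/
def StrictlyBelow (c d : C) : Prop :=
  Nonempty (c ⟶ d) ∧ ¬ Nonempty (c ≅ d)

/-- The `(G_d, G_c)`-biset structure on the set of morphisms `c ⟶ d`, as a left action of
`G_d × G_cᵒᵖ`: the pair `(g, h)` sends `f` to `g ∘ f ∘ h`. -/
instance bisetAction (c d : C) : MulAction (End d × (End c)ᵐᵒᵖ) (c ⟶ d) where
  smul p f := (show c ⟶ c from p.2.unop) ≫ f ≫ (show d ⟶ d from p.1)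
  one_smul f := by
    change 𝟙 c ≫ f ≫ 𝟙 d = f
    simp
  mul_smul p q f := by
    rcases p with ⟨a, b⟩
    rcases q with ⟨a', b'⟩
    change ((show c ⟶ c from b.unop) ≫ (show c ⟶ c from b'.unop)) ≫ f ≫
        ((show d ⟶ d from a') ≫ (show d ⟶ d from a)) =
      (show c ⟶ c from b.unop) ≫ ((show c ⟶ c from b'.unop) ≫ f ≫ (show d ⟶ d from a')) ≫
        (show d ⟶ d from a)
    simp only [Category.assoc]

/-- The biset stabilisers in `C(c, d)`: the subgroups `H` of `G_d × G_cᵒᵖ` such that the transitive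
biset `(G_d × G_cᵒᵖ) / H` occurs in `C(c, d)`, that is, the stabilisers of the elements
of `C(c, d)`. -/
def IsBisetStabiliser [EICategory C] {c d : C} (H : Subgroup (End d × (End c)ᵐᵒᵖ)) : Prop :=
  ∃ f : c ⟶ d, H = MulAction.stabilizer (End d × (End c)ᵐᵒᵖ) f

end Stabilisers

/-- A set is `k^×`-finite if its cardinality is finite and invertible in `k`. -/
def UnitFinite (k : Type u) [CommRing k] (X : Type u) : Prop :=
  Finite X ∧ IsUnit (Nat.card X : k)

/-- A category (of modules) is hereditary if every subobject of a projective object is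
projective. -/
def Hereditary (A : Type*) [Category A] : Prop :=
  ∀ {Q P : A} (i : Q ⟶ P), Mono i → Projective P → Projective Q

/-- Left `C`-modules over `k`: covariant functors from `C` to `k`-modules. -/
abbrev LeftMod (k : Type u) [CommRing k] (C : Type u) [SmallCategory C] :=
  C ⥤ ModuleCat.{u} k

/-- Right `C`-modules over `k`: contravariant functors from `C` to `k`-modules. -/
abbrev RightMod (k : Type u) [CommRing k] (C : Type u) [SmallCategory C] :=
  Cᵒᵖ ⥤ ModuleCat.{u} k

/-- A ring is (left) hereditary if its category of left modules is hereditary. -/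
def HereditaryRing (R : Type u) [Ring R] : Prop :=
  Hereditary (ModuleCat.{u} R)

end EICat

namespace EICat

/-! Necessity. If modules are hereditary and `π : F ⟶ P` goes between free modules, the image of `π`
is projective, so `F` has an endomorphism `σ` with `π ∘ σ = π` that kills the kernel of `π`
(`Hereditary.exists_endo_leftMod`). For well chosen `π`, the coefficients of `σ` on basis morphisms
carry the combinatorics. Left modules give that the projection of each biset stabiliser to the
automorphisms of the target is `k^×`-finite (`Hereditary.unitFinite_targetStabiliser`), and right
modules give the same for the source; the stabiliser embeds in the product. Unique factorisation
reduces to uniqueness of the last unfactorisable factor (`UniqueLastFactor`), which needs one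
argument on each side: `Hereditary.exists_iso_of_comp_eq` for left modules and
`Hereditary.exists_aut_of_comp_eq` for right ones. Hereditary group rings come from evaluating a
submodule of a free module at `c`, since evaluation preserves projectives when coinduction is exact
enough (`evRep_projective`).

Sufficiency. Let `i : Q ⟶ P` be mono with `P` projective, `e : N ⟶ N'` epi and `φ : Q ⟶ N'`. Each
`Q(c)` is projective over `kG_c`, so `φ` has pointwise lifts `g` natural for isomorphisms. Their
failure of naturality is a derivation from `Q` into the kernel of `e`. On unfactorisable morphisms
it extends equivariantly to `P`: semisimplicity of `k` extends the linear maps, and averaging over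
the finite automorphism group of each arrow makes them equivariant. Unique factorisation extends the
result to a derivation on all morphisms, and projectivity of `P` makes this derivation inner, say
given by `δ`. Then `e ∘ δ` is natural and lifts to `η : P ⟶ N`, and `g + (δ - η) ∘ i` is a natural
lift of `φ`. The hypotheses are self-dual, so the same theorem applied to `Cᵒᵖ` handles right
modules. -/

theorem StrictlyBelow.not_isIso {C : Type u} [SmallCategory C] {c d : C}
    (h : StrictlyBelow c d) (f : c ⟶ d) : ¬ IsIso f :=
  fun _ => h.2 ⟨asIso f⟩

/-! ### Invertible and unfactorisable morphisms in EI categories. -/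

section EI

variable {C : Type u} [SmallCategory C] [EICategory C]

theorem isIso_of_endo {c : C} (f : c ⟶ c) : IsIso f := EICategory.isIso_of_endo f

/-- Both composites are endomorphisms, hence invertible. In particular there is no morphism back
along a non-invertible one, which is why many values of free modules vanish. -/
theorem isIso_of_hom_hom {x y : C} (f : x ⟶ y) (g : y ⟶ x) : IsIso f := by
  have h1 := isIso_of_endo (f ≫ g)
  have h2 := isIso_of_endo (g ≫ f)
  have : Mono f := mono_of_mono f g
  have : IsSplitEpi f := ⟨⟨⟨inv (g ≫ f) ≫ g, by simp⟩⟩⟩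
  exact isIso_of_mono_of_isSplitEpi f

theorem isIso_left_of_comp {x y z : C} (f : x ⟶ y) (g : y ⟶ z) (h : IsIso (f ≫ g)) : IsIso f :=
  isIso_of_hom_hom f (g ≫ inv (f ≫ g))

theorem isIso_right_of_comp {x y z : C} (f : x ⟶ y) (g : y ⟶ z) (h : IsIso (f ≫ g)) : IsIso g :=
  isIso_of_hom_hom g (inv (f ≫ g) ≫ f)

theorem not_isIso_comp_left {x y z : C} {f : x ⟶ y} (g : y ⟶ z) (h : ¬ IsIso f) :
    ¬ IsIso (f ≫ g) := fun h' => h (isIso_left_of_comp f g h')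

theorem not_isIso_comp_right {x y z : C} (f : x ⟶ y) {g : y ⟶ z} (h : ¬ IsIso g) :
    ¬ IsIso (f ≫ g) := fun h' => h (isIso_right_of_comp f g h')

theorem isIso_of_iso {x y : C} (f : x ⟶ y) (e : x ≅ y) : IsIso f :=
  isIso_of_hom_hom f e.inv

theorem strictlyBelow_of_not_isIso {c d : C} (f : c ⟶ d) (h : ¬ IsIso f) : StrictlyBelow c d :=
  ⟨⟨f⟩, fun ⟨e⟩ => h (isIso_of_iso f e)⟩

theorem Unfactorisable.iso_comp {x y z : C} {α : y ⟶ z} (hα : Unfactorisable α) (h : x ⟶ y)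
    [IsIso h] : Unfactorisable (h ≫ α) := by
  refine ⟨not_isIso_comp_right h hα.1, ?_⟩
  rintro ⟨w, a, b, ha, hb, hab⟩
  exact hα.2 ⟨w, inv h ≫ a, b, not_isIso_comp_right _ ha, hb, by simp [hab]⟩

theorem Unfactorisable.comp_iso {x y z : C} {α : x ⟶ y} (hα : Unfactorisable α) (h : y ⟶ z)
    [IsIso h] : Unfactorisable (α ≫ h) := by
  refine ⟨not_isIso_comp_left h hα.1, ?_⟩
  rintro ⟨w, a, b, ha, hb, hab⟩
  exact hα.2 ⟨w, a, b ≫ inv h, ha, not_isIso_comp_left _ hb, by simp [reassoc_of% hab]⟩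

end EI

/-! ### Hereditary categories: invariance and splitting off images. -/

theorem Hereditary.of_equivalence {A B : Type*} [Category A] [Category B] (e : A ≌ B)
    (h : Hereditary B) : Hereditary A := by
  intro Q P i hi hP
  rw [← e.map_projective_iff]
  exact h (e.functor.map i) inferInstance ((e.map_projective_iff P).2 hP)

theorem hereditary_iff_of_equivalence {A B : Type*} [Category A] [Category B] (e : A ≌ B) :
    Hereditary A ↔ Hereditary B :=
  ⟨Hereditary.of_equivalence e.symm, Hereditary.of_equivalence e⟩

theorem hereditaryRing_monoidAlgebra_iff (k : Type u) [CommRing k] (G : Type u) [Monoid G] :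
    HereditaryRing (MonoidAlgebra k G) ↔ Hereditary (Rep.{u} k G) :=
  hereditary_iff_of_equivalence (Rep.equivalenceModuleMonoidAlgebra (k := k) (G := G)).symm

/-- Over a hereditary abelian category, a morphism to a projective object splits off its image. -/
theorem Hereditary.exists_endo {A : Type*} [Category A] [Abelian A] (hA : Hereditary A)
    {F P : A} (π : F ⟶ P) (hP : Projective P) :
    ∃ (Q : A) (e : F ⟶ Q) (m : Q ⟶ P) (σ : F ⟶ F), Mono m ∧ e ≫ m = π ∧ σ ≫ π = π ∧
      ∃ s : Q ⟶ F, σ = e ≫ s := by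
  have hQ : Projective (Limits.image π) := hA (Limits.image.ι π) inferInstance hP
  refine ⟨Limits.image π, Limits.factorThruImage π, Limits.image.ι π,
    Limits.factorThruImage π ≫ Projective.factorThru (𝟙 _) (Limits.factorThruImage π),
    inferInstance, Limits.image.fac π, ?_, _, rfl⟩
  refine (congrArg (_ ≫ ·) (Limits.image.fac π).symm).trans ?_
  rw [Category.assoc, Projective.factorThru_comp_assoc, Category.id_comp, Limits.image.fac]

/-! ### Modules over a category, free modules and evaluation at an object. -/

section Modules

variable {k : Type u} [CommRing k] {C : Type u} [SmallCategory C]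

theorem LeftMod.naturality_apply {M N : LeftMod k C} (η : M ⟶ N) {c d : C} (f : c ⟶ d)
    (x : M.obj c) :
    (η.app d).hom ((M.map f).hom x) = (N.map f).hom ((η.app c).hom x) := by
  have := congrArg (fun t => t.hom x) (η.naturality f)
  exact this

theorem LeftMod.map_comp_apply (M : LeftMod k C) {c d e : C} (f : c ⟶ d) (g : d ⟶ e)
    (x : M.obj c) : (M.map (f ≫ g)).hom x = (M.map g).hom ((M.map f).hom x) := by
  simp

theorem LeftMod.map_id_apply (M : LeftMod k C) {c : C} (x : M.obj c) :
    (M.map (𝟙 c)).hom x = x := by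
  simp

theorem LeftMod.mono_iff {M N : LeftMod k C} (η : M ⟶ N) :
    Mono η ↔ ∀ c, Function.Injective (η.app c).hom := by
  simp only [NatTrans.mono_iff_mono_app, ModuleCat.mono_iff_injective]

theorem LeftMod.epi_iff {M N : LeftMod k C} (η : M ⟶ N) :
    Epi η ↔ ∀ c, Function.Surjective (η.app c).hom := by
  simp only [NatTrans.epi_iff_epi_app, ModuleCat.epi_iff_surjective]

/-- A natural transformation from a pointwise family of linear maps. -/
def LeftMod.homMk {M N : LeftMod k C} (φ : ∀ c, M.obj c →ₗ[k] N.obj c)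
    (h : ∀ {c d : C} (f : c ⟶ d) (x : M.obj c),
      φ d ((M.map f).hom x) = (N.map f).hom (φ c x)) : M ⟶ N where
  app c := ModuleCat.ofHom (φ c)
  naturality c d f := by
    ext x
    exact h f x

/-- Elementwise form of the splitting. Every relation `π x = 0` becomes an equation `σ x = 0` inside
the free module `F`, where coefficients can be compared. -/
theorem Hereditary.exists_endo_leftMod (hA : Hereditary (LeftMod k C))
    {F P : LeftMod k C} (π : F ⟶ P) (hP : Projective P) :
    ∃ σ : F ⟶ F, (∀ c x, (π.app c).hom ((σ.app c).hom x) = (π.app c).hom x) ∧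
      ∀ c x, (π.app c).hom x = 0 → (σ.app c).hom x = 0 := by
  obtain ⟨Q, e, m, σ, hm, hem, hσ, s, hs⟩ := hA.exists_endo π hP
  rw [LeftMod.mono_iff] at hm
  refine ⟨σ, fun c x => ?_, fun c x hx => ?_⟩
  · exact congrArg (fun t => (t.app c).hom x) hσ
  · have h0 : (e.app c).hom x = 0 := by
      apply hm c
      rw [map_zero, ← hx, ← hem]
      rfl
    rw [hs]
    change (s.app c).hom ((e.app c).hom x) = 0
    rw [h0, map_zero]

/-- The direct sum of the representable left modules of the objects `z i`. -/
noncomputable def freeOn (k : Type u) [CommRing k] {I : Type u} (z : I → C) : LeftMod k C where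
  obj w := ModuleCat.of k ((Σ i, z i ⟶ w) →₀ k)
  map f := ModuleCat.ofHom (Finsupp.lmapDomain k k fun p => ⟨p.1, p.2 ≫ f⟩)
  map_id w := by
    refine ModuleCat.hom_ext (Finsupp.lhom_ext fun p r => ?_)
    refine Finsupp.mapDomain_single.trans ?_
    simp
  map_comp f g := by
    refine ModuleCat.hom_ext (Finsupp.lhom_ext fun p r => ?_)
    refine Finsupp.mapDomain_single.trans (Eq.symm ?_)
    refine (congrArg (Finsupp.mapDomain _) Finsupp.mapDomain_single).trans ?_
    refine Finsupp.mapDomain_single.trans ?_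
    simp

section FreeOn

variable {I : Type u} {z : I → C}

/-- The basis of a value of `freeOn k z`. -/
noncomputable def freeEquiv (k : Type u) [CommRing k] (z : I → C) (w : C) :
    (freeOn k z).obj w ≃ₗ[k] ((Σ i, z i ⟶ w) →₀ k) :=
  LinearEquiv.refl k _

/-- The basis elements of `freeOn k z`. -/
noncomputable def freeSingle (k : Type u) [CommRing k] (z : I → C) {w : C} (i : I)
    (a : z i ⟶ w) : (freeOn k z).obj w :=
  (freeEquiv k z w).symm (Finsupp.single ⟨i, a⟩ 1)

theorem freeEquiv_single {w : C} (i : I) (a : z i ⟶ w) :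
    freeEquiv k z w (freeSingle k z i a) = Finsupp.single ⟨i, a⟩ 1 :=
  LinearEquiv.apply_symm_apply _ _

theorem freeOn_map_single {v w : C} (f : v ⟶ w) (i : I) (a : z i ⟶ v) :
    ((freeOn k z).map f).hom (freeSingle k z i a) = freeSingle k z i (a ≫ f) :=
  Finsupp.mapDomain_single

theorem freeOn_lhom_ext {w : C} {M : Type*} [AddCommGroup M] [Module k M]
    {φ ψ : (freeOn k z).obj w →ₗ[k] M}
    (h : ∀ i (a : z i ⟶ w), φ (freeSingle k z i a) = ψ (freeSingle k z i a)) : φ = ψ :=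
  Finsupp.lhom_ext' fun p => LinearMap.ext_ring (h p.1 p.2)

theorem freeOn_subsingleton {w : C} (h : ∀ i, IsEmpty (z i ⟶ w)) (x : (freeOn k z).obj w) :
    x = 0 := by
  have : (LinearMap.id : (freeOn k z).obj w →ₗ[k] (freeOn k z).obj w) = 0 :=
    freeOn_lhom_ext fun i a => ((h i).false a).elim
  exact LinearMap.congr_fun this x

/-- Linear maps out of a value of `freeOn k z`. -/
noncomputable def freeLift (w : C) {M : Type*} [AddCommGroup M] [Module k M]
    (q : ∀ i, (z i ⟶ w) → M) : (freeOn k z).obj w →ₗ[k] M :=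
  Finsupp.linearCombination k (fun p : Σ i, z i ⟶ w => q p.1 p.2) ∘ₗ
    (freeEquiv k z w).toLinearMap

@[simp] theorem freeLift_single {w : C} {M : Type*} [AddCommGroup M] [Module k M]
    (q : ∀ i, (z i ⟶ w) → M) (i : I) (a : z i ⟶ w) :
    freeLift w q (freeSingle k z i a) = q i a := by
  rw [freeLift, LinearMap.comp_apply, LinearEquiv.coe_coe, freeEquiv_single,
    Finsupp.linearCombination_single, one_smul]

/-- The morphism out of a direct sum of representables given by elements. -/
noncomputable def freeDesc {M : LeftMod k C} (q : ∀ i, M.obj (z i)) : freeOn k z ⟶ M :=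
  LeftMod.homMk (fun w => freeLift w fun i a => (M.map a).hom (q i)) fun {c d} f x => by
    have : freeLift d (fun i a => (M.map a).hom (q i)) ∘ₗ ((freeOn k z).map f).hom =
        (M.map f).hom ∘ₗ freeLift c fun i a => (M.map a).hom (q i) := by
      refine freeOn_lhom_ext fun i a => ?_
      simp only [LinearMap.comp_apply, freeOn_map_single, freeLift_single, LeftMod.map_comp_apply]
    exact LinearMap.congr_fun this x

theorem freeDesc_single {M : LeftMod k C} (q : ∀ i, M.obj (z i)) {w : C} (i : I)
    (a : z i ⟶ w) :
    ((freeDesc q).app w).hom (freeSingle k z i a) = (M.map a).hom (q i) :=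
  freeLift_single _ _ _

theorem freeOn_hom_ext {M : LeftMod k C} {φ ψ : freeOn k z ⟶ M}
    (h : ∀ i, (φ.app (z i)).hom (freeSingle k z i (𝟙 _)) =
      (ψ.app (z i)).hom (freeSingle k z i (𝟙 _))) : φ = ψ := by
  ext w : 2
  refine ModuleCat.hom_ext (freeOn_lhom_ext fun i a => ?_)
  have h1 : freeSingle k z i a = ((freeOn k z).map a).hom (freeSingle k z i (𝟙 _)) := by
    rw [freeOn_map_single, Category.id_comp]
  rw [h1, LeftMod.naturality_apply, LeftMod.naturality_apply, h]

theorem freeOn_projective (z : I → C) : Projective (freeOn k z) where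
  factors {E X} f e he := by
    rw [LeftMod.epi_iff] at he
    choose q hq using fun i => he (z i) ((f.app (z i)).hom (freeSingle k z i (𝟙 _)))
    refine ⟨freeDesc q, freeOn_hom_ext fun i => ?_⟩
    change (e.app _).hom (((freeDesc q).app _).hom _) = _
    rw [freeDesc_single, LeftMod.map_id_apply, hq]

end FreeOn

/-- The value of a left module at `c` as a representation of the endomorphism monoid. -/
noncomputable def evRep (M : LeftMod k C) (c : C) : Rep.{u} k (End c) :=
  Rep.of (X := M.obj c)
    { toFun g := (M.map (show c ⟶ c from g)).hom
      map_one' := by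
        ext x
        exact M.map_id_apply x
      map_mul' g h := by
        ext x
        exact M.map_comp_apply (show c ⟶ c from h) (show c ⟶ c from g) x }

end Modules

/-! ### Groups of finite invertible order, and stabilisers. -/

section UnitFinite

variable {k : Type u} [CommRing k]

theorem UnitFinite.of_injective {G H : Type u} [Group G] [Group H] (hG : UnitFinite k G)
    (φ : H →* G) (hφ : Function.Injective φ) : UnitFinite k H := by
  obtain ⟨hfin, hu⟩ := hG
  have : Finite H := Finite.of_injective φ hφ
  refine ⟨this, isUnit_of_dvd_unit ?_ hu⟩
  exact_mod_cast Nat.cast_dvd_cast (Subgroup.card_dvd_of_injective φ hφ)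

theorem UnitFinite.prod {X Y : Type u} (hX : UnitFinite k X) (hY : UnitFinite k Y) :
    UnitFinite k (X × Y) := by
  obtain ⟨hX, hX'⟩ := hX
  obtain ⟨hY, hY'⟩ := hY
  refine ⟨inferInstance, ?_⟩
  rw [Nat.card_prod, Nat.cast_mul]
  exact hX'.mul hY'

/-- The finite support of `s` is a nonempty union of right cosets of `S`, so `S` is finite. Since
`s` is constant on each coset, summing coset by coset shows that the cardinality of `S` divides the
total sum `1`. -/
theorem unitFinite_of_invariant [Nontrivial k] {G : Type u} [Group G] (S : Subgroup G)
    (s : G →₀ k) (hs : ∀ g ∈ S, ∀ a, s (g * a) = s a) (h1 : s.sum (fun _ r => r) = 1) :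
    UnitFinite k S := by
  classical
  obtain ⟨a, ha⟩ : s.support.Nonempty := by
    rw [Finset.nonempty_iff_ne_empty]
    intro h
    simp [Finsupp.sum, h] at h1
  have hfin : Finite S := by
    refine Finite.of_injective
      (fun g : S => (⟨g * a, ?_⟩ : (s.support : Set G))) fun g g' h => ?_
    · rw [Finset.mem_coe, Finsupp.mem_support_iff, hs g g.2]
      exact Finsupp.mem_support_iff.1 ha
    · exact Subtype.ext (mul_right_cancel (congrArg Subtype.val h))
  refine ⟨hfin, isUnit_of_dvd_one ?_⟩
  have := Fintype.ofFinite S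
  rw [← h1, Finsupp.sum, ← Finset.sum_fiberwise_of_maps_to
    (g := fun x => (Quotient.mk (QuotientGroup.rightRel S) x)) (t := s.support.image _)
    (fun x hx => Finset.mem_image_of_mem _ hx)]
  refine Finset.dvd_sum fun q hq => ?_
  obtain ⟨x, hx, rfl⟩ := Finset.mem_image.1 hq
  have hset : s.support.filter (fun y => Quotient.mk (QuotientGroup.rightRel S) y =
      Quotient.mk (QuotientGroup.rightRel S) x) =
      Finset.univ.image fun g : S => (g : G) * x := by
    ext y
    simp only [Finset.mem_filter, Finsupp.mem_support_iff, Finset.mem_image, Finset.mem_univ,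
      true_and, Quotient.eq, QuotientGroup.rightRel_apply]
    constructor
    · rintro ⟨-, h⟩
      refine ⟨⟨_, S.inv_mem h⟩, ?_⟩
      simp
    · rintro ⟨g, rfl⟩
      refine ⟨?_, by simp⟩
      rw [hs g g.2]
      exact Finsupp.mem_support_iff.1 hx
  rw [hset, Finset.sum_image fun g _ g' _ h => Subtype.ext (mul_right_cancel h)]
  simp only [hs _ (Subtype.prop _), Finset.sum_const, Finset.card_univ, nsmul_eq_mul,
    Nat.card_eq_fintype_card]
  exact dvd_mul_right _ _

end UnitFinite

section

variable {C : Type u} [SmallCategory C] [EICategory C]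

theorem end_comp_inv {c : C} (g : End c) :
    (show c ⟶ c from g) ≫ (show c ⟶ c from (g⁻¹ : End c)) = 𝟙 c :=
  inv_mul_cancel g

/-- The projection of the biset stabiliser of `f : x ⟶ y` to `End y`. -/
def targetStabiliser {x y : C} (f : x ⟶ y) : Subgroup (End y) where
  carrier := {g | ∃ h : x ⟶ x, f ≫ (show y ⟶ y from g) = h ≫ f}
  one_mem' := ⟨𝟙 x, by rw [Category.id_comp]; exact Category.comp_id f⟩
  mul_mem' := by
    rintro a b ⟨h, hh⟩ ⟨h', hh'⟩
    refine ⟨h' ≫ h, ?_⟩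
    change f ≫ ((show y ⟶ y from b) ≫ (show y ⟶ y from a)) = _
    rw [reassoc_of% hh', hh, Category.assoc]
  inv_mem' := by
    rintro a ⟨h, hh⟩
    have := isIso_of_endo h
    refine ⟨inv h, ?_⟩
    rw [IsIso.eq_inv_comp, ← reassoc_of% hh, end_comp_inv, Category.comp_id]

end

/-! ### Consequences of heredity for morphisms. -/

section Hereditary

variable {k : Type u} [CommRing k] {C : Type u} [SmallCategory C]

/-- The indicator functional of a set of basis elements. -/
noncomputable def indicator {I : Type u} (k : Type u) [CommRing k] {z : I → C} {w : C}
    (B : ∀ i, (z i ⟶ w) → Prop) : (freeOn k z).obj w →ₗ[k] k := by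
  classical
  exact freeLift w fun i a => if B i a then 1 else 0

open Classical in
theorem indicator_single {I : Type u} {z : I → C} {w : C} (B : ∀ i, (z i ⟶ w) → Prop) (i : I)
    (a : z i ⟶ w) : indicator k B (freeSingle k z i a) = if B i a then 1 else 0 := by
  rw [indicator, freeLift_single]

theorem indicator_true_single {I : Type u} {z : I → C} {w : C} (i : I) (a : z i ⟶ w) :
    indicator k (fun _ _ => True) (freeSingle k z i a) = 1 := by
  rw [indicator_single, if_pos trivial]

theorem indicator_true_map {I : Type u} {z : I → C} {v w : C} (f : v ⟶ w)
    (x : (freeOn k z).obj v) :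
    indicator k (fun _ _ => True) (((freeOn k z).map f).hom x) =
      indicator k (fun _ _ => True) x := by
  have h : indicator k (fun _ _ => True) ∘ₗ ((freeOn k z).map f).hom =
      indicator k (fun _ _ => True) := by
    refine freeOn_lhom_ext fun i a => ?_
    simp only [LinearMap.comp_apply, freeOn_map_single, indicator_single]
  exact LinearMap.congr_fun h x

variable [EICategory C] [Nontrivial k]

open Classical in
/-- A morphism is an epimorphism up to automorphisms if left modules are hereditary. -/
theorem Hereditary.exists_aut_of_comp_eq (hA : Hereditary (LeftMod k C)) {x y z : C} (f : x ⟶ y)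
    (g g' : y ⟶ z) (h : f ≫ g = f ≫ g') : ∃ t : y ⟶ y, f ≫ t = f ∧ t ≫ g = g' := by
  let π : freeOn k (fun _ : PUnit.{u + 1} => y) ⟶ freeOn k (fun _ : PUnit.{u + 1} => x) :=
    freeDesc fun i => freeSingle k _ i f
  have hπ : ∀ {w : C} (i) (a : y ⟶ w), (π.app w).hom (freeSingle k _ i a) =
      freeSingle k _ i (f ≫ a) := fun i a => by
    rw [freeDesc_single, freeOn_map_single]
  obtain ⟨σ, hσ, hσ0⟩ := hA.exists_endo_leftMod π (freeOn_projective _)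
  -- `s` is a `k`-combination of endomorphisms of `y`. Precomposing with `f` turns it into the basis
  -- element `f`, while `g` and `g'` become equal after precomposition with `s`.
  let s := (σ.app y).hom (freeSingle k _ PUnit.unit (𝟙 y))
  have hs : (π.app y).hom s = freeSingle k _ PUnit.unit f := by
    rw [hσ, hπ, Category.comp_id]
  have hsg : ((freeOn k _).map g).hom s = ((freeOn k _).map g').hom s := by
    rw [← sub_eq_zero, ← LeftMod.naturality_apply, ← LeftMod.naturality_apply,
      freeOn_map_single, freeOn_map_single, ← map_sub]
    apply hσ0
    rw [map_sub, hπ, hπ, Category.id_comp, Category.id_comp, h, sub_self]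
  -- If `B` is stable under precomposition by the automorphisms fixing `f`, then whether `a ≫ b`
  -- lies in `B` depends only on `f ≫ a`. Hence the total coefficient of `B` in the image of `s`
  -- under `b` can be read off from `π s = f`, and is `1` or `0` according to whether `b` is in `B`.
  have key : ∀ (B : (y ⟶ z) → Prop) (_ : ∀ t b, f ≫ t = f → B b → B (t ≫ b)) (b : y ⟶ z),
      indicator k (fun _ => B) (((freeOn k fun _ : PUnit.{u + 1} => y).map b).hom s) =
        indicator k (fun _ _ => B b) (freeSingle k (fun _ : PUnit.{u + 1} => x) PUnit.unit f) := by
    intro B hB b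
    have h1 : indicator k (fun _ => B) ∘ₗ ((freeOn k fun _ : PUnit.{u + 1} => y).map b).hom =
        indicator k (fun (_ : PUnit.{u + 1}) c => ∃ r : y ⟶ y, f ≫ r = c ∧ B (r ≫ b)) ∘ₗ
          (π.app y).hom := by
      refine freeOn_lhom_ext fun i a => ?_
      simp only [LinearMap.comp_apply, freeOn_map_single, hπ, indicator_single]
      refine if_congr ⟨fun h => ⟨a, rfl, h⟩, ?_⟩ rfl rfl
      rintro ⟨r, hr, hB'⟩
      have := isIso_of_endo r
      have := hB (a ≫ inv r) _ (by rw [← reassoc_of% hr]; simp) hB'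
      simpa using this
    refine (LinearMap.congr_fun h1 s).trans ?_
    rw [LinearMap.comp_apply, hs, indicator_single, indicator_single]
    refine if_congr ⟨?_, fun h => ⟨𝟙 y, by simp, by simpa using h⟩⟩ rfl rfl
    rintro ⟨r, hr, hB'⟩
    have := isIso_of_endo r
    have := hB (inv r) _ (by rw [IsIso.comp_inv_eq, hr]) hB'
    simpa using this
  -- Take for `B` the orbit of `g`: as `g` and `g'` give the same image of `s`, and `g` is in the
  -- orbit, so is `g'`.
  have h2 := key (fun b => ∃ t : y ⟶ y, f ≫ t = f ∧ t ≫ g = b)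
    (by rintro t _ ht ⟨t', ht', rfl⟩; exact ⟨t ≫ t', by rw [reassoc_of% ht, ht'], by simp⟩)
  have h3 := (h2 g).symm.trans ((congrArg _ hsg).trans (h2 g'))
  rw [indicator_single, indicator_single, if_pos ⟨𝟙 y, by simp, by simp⟩] at h3
  by_contra hcon
  rw [if_neg hcon] at h3
  exact one_ne_zero h3

/-- The splitting yields an element `s` of the group algebra of `End y` that is invariant under the
stabiliser and has coefficient sum `1`, so `unitFinite_of_invariant` applies. -/
theorem Hereditary.unitFinite_targetStabiliser (hA : Hereditary (LeftMod k C)) {x y : C}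
    (f : x ⟶ y) (hf : ¬ IsIso f) : UnitFinite k (targetStabiliser f) := by
  -- One generator at `y` is sent to `f`, and for each automorphism `t` of `x` one generator at `x`
  -- is sent to `1 - t`. The latter turn `f ≫ g = t ≫ f` into a relation whose correction term
  -- disappears under the projection `ρ` to the summand at `y`.
  let z : Option (End x) → C := fun o => o.elim y fun _ => x
  let q : ∀ o, (freeOn k (fun _ : PUnit.{u + 1} => x)).obj (z o) := fun o => match o with
    | none => freeSingle k _ PUnit.unit f
    | some t => freeSingle k _ PUnit.unit (𝟙 x) - freeSingle k _ PUnit.unit (show x ⟶ x from t)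
  let π := freeDesc q
  obtain ⟨σ, hσ, hσ0⟩ := hA.exists_endo_leftMod π (freeOn_projective _)
  let ρ : freeOn k z ⟶ freeOn k (fun _ : PUnit.{u + 1} => y) := freeDesc fun o => match o with
    | none => freeSingle k _ PUnit.unit (𝟙 y)
    | some t => 0
  let e : (freeOn k z).obj y := freeSingle k z none (𝟙 y)
  let s := (ρ.app y).hom ((σ.app y).hom e)
  have hinv : ∀ g ∈ targetStabiliser f, ((freeOn k _).map (show y ⟶ y from g)).hom s = s := by
    rintro g ⟨t, ht⟩
    let e' : (freeOn k z).obj x := freeSingle k z (some t) (𝟙 x)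
    -- There is no morphism `y ⟶ x`, because `f` is not invertible.
    have h0 : (ρ.app x).hom ((σ.app x).hom e') = 0 :=
      freeOn_subsingleton (fun _ => ⟨fun a => hf (isIso_of_hom_hom f a)⟩) _
    have h1 : (σ.app y).hom (((freeOn k z).map (show y ⟶ y from g)).hom e - e +
        ((freeOn k z).map f).hom e') = 0 := by
      apply hσ0
      rw [map_add, map_sub, LeftMod.naturality_apply, LeftMod.naturality_apply]
      have h2 : (π.app y).hom e = freeSingle k _ PUnit.unit f :=
        (freeDesc_single q none (𝟙 y)).trans (LeftMod.map_id_apply _ _)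
      have h3 : (π.app x).hom e' = freeSingle k _ PUnit.unit (𝟙 x) -
          freeSingle k _ PUnit.unit (show x ⟶ x from t) :=
        (freeDesc_single q (some t) (𝟙 x)).trans (LeftMod.map_id_apply _ _)
      rw [h2, h3, map_sub, freeOn_map_single, freeOn_map_single, freeOn_map_single, ht,
        Category.id_comp]
      abel
    have h4 := congrArg (ρ.app y).hom h1
    rw [map_add, map_sub, LeftMod.naturality_apply, LeftMod.naturality_apply, map_add, map_sub,
      LeftMod.naturality_apply, LeftMod.naturality_apply, h0, map_zero, map_zero, add_zero,
      sub_eq_zero] at h4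
    exact h4
  -- `ρ` and `π` have the same coefficient sum on all generators: `1` at `y`, and `0` at `x` since
  -- `1 - t` has sum `0`. The sum for `s` is thus that of `π (σ e) = π e = f`.
  have haug : indicator k (fun _ _ => True) s = 1 := by
    have h1 : indicator k (fun _ _ => True) ∘ₗ (ρ.app y).hom =
        indicator k (fun _ _ => True) ∘ₗ (π.app y).hom := by
      refine freeOn_lhom_ext fun i a => ?_
      simp only [LinearMap.comp_apply]
      rw [freeDesc_single, freeDesc_single, indicator_true_map, indicator_true_map]
      cases i with
      | none => exact (indicator_true_single _ _).trans (indicator_true_single _ _).symm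
      | some t =>
        refine (map_zero _).trans (Eq.symm ((map_sub _ _ _).trans ?_))
        exact sub_eq_zero.2 ((indicator_true_single _ _).trans (indicator_true_single _ _).symm)
    refine (LinearMap.congr_fun h1 ((σ.app y).hom e)).trans ?_
    refine (congrArg (indicator k fun _ _ => True)
      ((hσ y e).trans (freeDesc_single q none (𝟙 y)))).trans ?_
    exact (indicator_true_map (𝟙 y) (q none)).trans (indicator_true_single _ _)
  let τ : (freeOn k (fun _ : PUnit.{u + 1} => y)).obj y →ₗ[k] (End y →₀ k) :=
    freeLift y fun _ a => Finsupp.single (show End y from a) 1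
  refine unitFinite_of_invariant _ (τ s) (fun g hg a => ?_) ?_
  · have h1 : τ ∘ₗ ((freeOn k _).map (show y ⟶ y from g)).hom =
        Finsupp.lmapDomain k k (g * ·) ∘ₗ τ := by
      refine freeOn_lhom_ext fun i a => ?_
      simp only [LinearMap.comp_apply, τ, freeOn_map_single, freeLift_single,
        Finsupp.lmapDomain_apply, Finsupp.mapDomain_single]
      rfl
    have h2 := LinearMap.congr_fun h1 s
    rw [LinearMap.comp_apply, hinv g hg] at h2
    refine (DFunLike.congr_fun h2 (g * a)).trans ?_
    exact Finsupp.mapDomain_apply (mul_right_injective g) _ a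
  · rw [← haug]
    have h1 : Finsupp.linearCombination k (fun _ : End y => (1 : k)) ∘ₗ τ =
        indicator k (fun _ _ => True) := by
      refine freeOn_lhom_ext fun i a => ?_
      simp [τ, indicator_single]
    rw [← h1, LinearMap.comp_apply, Finsupp.linearCombination_apply]
    simp

/-- Distinct unfactorisable morphisms completing a commutative square are related by an
isomorphism if left modules are hereditary. -/
theorem Hereditary.exists_iso_of_comp_eq (hA : Hereditary (LeftMod k C)) {x y z z' : C}
    (u : x ⟶ z) (u' : x ⟶ z') (α : z ⟶ y) (α' : z' ⟶ y) (hα : Unfactorisable α)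
    (hα' : Unfactorisable α') (h : u ≫ α = u' ≫ α') : ∃ h : z ≅ z', h.hom ≫ α' = α := by
  by_contra hcon
  let I := ULift.{u} Bool
  let zz : I → C := fun i => match i with | ⟨true⟩ => z | ⟨false⟩ => z'
  let uu : ∀ i : I, x ⟶ zz i := fun i => match i with | ⟨true⟩ => u | ⟨false⟩ => u'
  let αα : ∀ i : I, zz i ⟶ y := fun i => match i with | ⟨true⟩ => α | ⟨false⟩ => α'
  have hunf : ∀ i, Unfactorisable (αα i) := by rintro ⟨_ | _⟩ <;> assumption
  have hcomp : ∀ i, uu i ≫ αα i = u ≫ α := by rintro ⟨_ | _⟩ <;> simp [uu, αα, h]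
  have hiso : ∀ i j, i ≠ j → ¬ ∃ h : zz i ≅ zz j, h.hom ≫ αα j = αα i := by
    rintro ⟨_ | _⟩ ⟨_ | _⟩ hij ⟨t, ht⟩
    · exact hij rfl
    · exact hcon ⟨t.symm, by rw [← show t.hom ≫ α = α' from ht]; exact t.inv_hom_id_assoc α⟩
    · exact hcon ⟨t, ht⟩
    · exact hij rfl
  let π : freeOn k zz ⟶ freeOn k (fun _ : PUnit.{u + 1} => x) :=
    freeDesc fun i => freeSingle k _ PUnit.unit (uu i)
  have hπ : ∀ {w : C} (i) (a : zz i ⟶ w), (π.app w).hom (freeSingle k zz i a) =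
      freeSingle k _ PUnit.unit (uu i ≫ a) := fun i a => by
    rw [freeDesc_single, freeOn_map_single]
  obtain ⟨σ, hσ, hσ0⟩ := hA.exists_endo_leftMod π (freeOn_projective _)
  let v : I → (freeOn k zz).obj y := fun i => (σ.app y).hom (freeSingle k zz i (αα i))
  have hv : ∀ i j, v i = v j := fun i j => by
    rw [← sub_eq_zero, ← map_sub]
    apply hσ0
    rw [map_sub, hπ, hπ, hcomp, hcomp, sub_self]
  have hv' : ∀ i, v i = ((freeOn k zz).map (αα i)).hom
      ((σ.app _).hom (freeSingle k zz i (𝟙 _))) := fun i => by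
    rw [← LeftMod.naturality_apply, freeOn_map_single, Category.id_comp]
  have hcoeff : ∀ (i : I) {w w' : C} (f : w ⟶ w') (b : zz i ⟶ w') (t : (freeOn k zz).obj w),
      (∀ r : zz i ⟶ w, r ≫ f ≠ b) →
        freeEquiv k zz w' (((freeOn k zz).map f).hom t) ⟨i, b⟩ = 0 := by
    intro i w w' f b t hb
    refine Finsupp.mapDomain_of_notMem_range _ _ ?_
    rintro ⟨⟨j, r⟩, hr⟩
    obtain ⟨rfl, hr⟩ := Sigma.mk.inj_iff.1 hr
    exact hb r (eq_of_heq hr)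
  -- All `v i` are equal, and `v i` is supported on morphisms factoring through `αα i`. A
  -- coefficient at `b`, out of `zz j`, vanishes by looking at `v j` unless `b = g ≫ αα j`. In that
  -- case look at `v l` with `l ≠ j`: an equation `r ≫ αα l = g ≫ αα j` would force `r` to be
  -- invertible, contradicting `hiso`.
  have hzero : ∀ i, v i = 0 := by
    intro i
    apply (freeEquiv k zz y).injective
    rw [map_zero]
    ext ⟨j, b⟩
    by_cases hb : ∃ g : zz j ⟶ zz j, g ≫ αα j = b
    · obtain ⟨g, rfl⟩ := hb
      obtain ⟨l, hl⟩ : ∃ l, j ≠ l := by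
        obtain ⟨_ | _⟩ := j
        exacts [⟨⟨true⟩, by simp [I]⟩, ⟨⟨false⟩, by simp [I]⟩]
      rw [hv i l, hv']
      refine hcoeff _ _ _ _ fun r hr => ?_
      have := isIso_of_endo g
      by_cases hr' : IsIso r
      · refine hiso j l hl ⟨asIso (inv g ≫ r), ?_⟩
        simp [hr]
      · exact ((hunf j).iso_comp g).2 ⟨_, r, αα l, hr', (hunf l).1, hr⟩
    · push Not at hb
      rw [hv i j, hv']
      exact hcoeff _ _ _ _ hb
  have h1 := hσ y (freeSingle k zz ⟨true⟩ (αα ⟨true⟩))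
  rw [show (σ.app y).hom (freeSingle k zz ⟨true⟩ (αα ⟨true⟩)) = 0 from hzero _, map_zero, hπ] at h1
  have h2 := congrArg (indicator k fun _ _ => True) h1
  rw [map_zero, indicator_single, if_pos trivial] at h2
  exact zero_ne_one h2

end Hereditary

/-! ### Averaging and transport along isomorphisms. -/

section Averaging

variable {k : Type u} [CommRing k]

/-- Averaging over a group whose order is invertible. -/
theorem UnitFinite.exists_invariant {H : Type u} [Group H] (hH : UnitFinite k H)
    {A B : Type*} [AddCommGroup A] [Module k A] [AddCommGroup B] [Module k B]
    (act : H → A →ₗ[k] A) (hact : ∀ g h a, act g (act h a) = act (g * h) a)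
    (e : A →ₗ[k] B) (b : B) (a : A) (ha : ∀ h, e (act h a) = b) :
    ∃ a', e a' = b ∧ ∀ h, act h a' = a' := by
  obtain ⟨hfin, hu⟩ := hH
  have := Fintype.ofFinite H
  obtain ⟨n, hn⟩ := hu
  rw [Nat.card_eq_fintype_card] at hn
  refine ⟨(↑n⁻¹ : k) • ∑ h, act h a, ?_, fun g => ?_⟩
  · rw [map_smul, map_sum, Finset.sum_congr rfl fun h _ => ha h, Finset.sum_const,
      Finset.card_univ, ← Nat.cast_smul_eq_nsmul k, ← hn, smul_smul, Units.inv_mul, one_smul]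
  · rw [map_smul, map_sum]
    congr 1
    simp only [hact]
    exact Fintype.sum_equiv (Equiv.mulLeft g) _ _ fun h => rfl

/-- Automorphism invariant elements propagate along the isomorphisms of a category. -/
theorem exists_iso_invariant_family {W : Type*} [Category W] (M : W → Type*)
    (act : ∀ {a b : W}, (a ≅ b) → M a → M b)
    (act_trans : ∀ {a b c : W} (φ : a ≅ b) (ψ : b ≅ c) (m : M a),
      act (φ ≪≫ ψ) m = act ψ (act φ m))
    (X : ∀ w, M w → Prop) (hX : ∀ {a b : W} (φ : a ≅ b) (m : M a), X a m → X b (act φ m))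
    (h : ∀ w, ∃ m, X w m ∧ ∀ φ : w ≅ w, act φ m = m) :
    ∃ s : ∀ w, M w, (∀ w, X w (s w)) ∧ ∀ {a b : W} (φ : a ≅ b), act φ (s a) = s b := by
  choose m hm hm' using h
  let r : W → W := fun w => Quotient.out (s := isIsomorphicSetoid W) (Quotient.mk _ w)
  have ι : ∀ w, r w ≅ w := fun w =>
    (Quotient.exact (s := isIsomorphicSetoid W) (Quotient.out_eq (Quotient.mk _ w))).some
  -- Two isomorphisms out of the same representative differ by an automorphism, which fixes the
  -- chosen element. The equality `a = a'` is kept as a hypothesis because representatives of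
  -- isomorphic objects agree only propositionally.
  have key : ∀ {a a' b : W} (_ : a = a') (p : a ≅ b) (q : a' ≅ b),
      act p (m a) = act q (m a') := by
    rintro a _ b rfl p q
    have := act_trans (p ≪≫ q.symm) q (m a)
    rwa [Iso.trans_assoc, Iso.symm_self_id, Iso.trans_refl, hm'] at this
  refine ⟨fun w => act (ι w) (m (r w)), fun w => hX _ _ (hm _), fun {a b} φ => ?_⟩
  rw [← act_trans]
  refine key ?_ _ _
  exact congrArg (Quotient.out (s := isIsomorphicSetoid W))
    (Quotient.sound (s := isIsomorphicSetoid W) ⟨φ⟩)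

end Averaging

/-! ### Evaluation at an object and coinduction. -/

section

variable {k : Type u} [CommRing k] {C : Type u} [SmallCategory C]

/-- Here `e` need not be epi: `φ` dies in the cokernel of `e`, and projectives lift through
exactness at `B`. -/
theorem LeftMod.exists_lift_of_range {M A B : LeftMod k C} (hM : Projective M) (e : A ⟶ B)
    (φ : M ⟶ B) (h : ∀ c x, ∃ a, (e.app c).hom a = (φ.app c).hom x) : ∃ ψ : M ⟶ A, ψ ≫ e = φ := by
  have hex := ShortComplex.exact_cokernel e
  have h0 : φ ≫ Limits.cokernel.π e = 0 := by
    ext c x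
    obtain ⟨a, ha⟩ := h c x
    change ((Limits.cokernel.π e).app c).hom ((φ.app c).hom x) = 0
    rw [← ha]
    exact congrArg (fun t => (t.app c).hom a) (Limits.cokernel.condition e)
  exact ⟨hex.liftFromProjective φ h0, hex.liftFromProjective_comp φ h0⟩

/-- The left module coinduced from a representation of `End c`. -/
def coind {c : C} (N : Rep.{u} k (End c)) : LeftMod k C where
  obj d := ModuleCat.of k
    ({ carrier := {n | ∀ (f : d ⟶ c) (g : End c), n (f ≫ (show c ⟶ c from g)) = N.ρ g (n f)}
       add_mem' := fun ha hb f g => by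
        rw [Pi.add_apply, Pi.add_apply, ha, hb, map_add]
       zero_mem' := fun f g => (map_zero _).symm
       smul_mem' := fun r n hn f g => by
        rw [Pi.smul_apply, Pi.smul_apply, hn, map_smul] } : Submodule k ((d ⟶ c) → N.V))
  map {d d'} f := ModuleCat.ofHom
    { toFun n := ⟨fun h => n.1 (f ≫ h), fun h g =>
        (congrArg n.1 (Category.assoc f h _).symm).trans (n.2 (f ≫ h) g)⟩
      map_add' _ _ := rfl
      map_smul' _ _ := rfl }
  map_id d := by
    refine ModuleCat.hom_ext (LinearMap.ext fun n => Subtype.ext (funext fun h => ?_))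
    exact congrArg n.1 (Category.id_comp h)
  map_comp f g := by
    refine ModuleCat.hom_ext (LinearMap.ext fun n => Subtype.ext (funext fun h => ?_))
    exact congrArg n.1 (Category.assoc f g h)

variable [EICategory C]

/-- The stabiliser of a morphism under the automorphisms of its target. -/
def leftStabiliser {d c : C} (f : d ⟶ c) : Subgroup (End c) where
  carrier := {g | f ≫ (show c ⟶ c from g) = f}
  one_mem' := Category.comp_id f
  mul_mem' := fun {a b} ha hb => by
    change f ≫ ((show c ⟶ c from b) ≫ (show c ⟶ c from a)) = f
    rw [← Category.assoc, show f ≫ (show c ⟶ c from b) = f from hb]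
    exact ha
  inv_mem' := fun {a} ha => by
    change f ≫ (show c ⟶ c from (a⁻¹ : End c)) = f
    conv_lhs => rw [← show f ≫ (show c ⟶ c from a) = f from ha]
    rw [Category.assoc, end_comp_inv, Category.comp_id]

/-- An equivariant function is determined by its values on orbit representatives, and the value at
`f` can be any vector fixed by the stabiliser of `f`. Averaging over that stabiliser replaces an
arbitrary lift of `b f` by a fixed one. -/
theorem coind_lift {c d : C} {A B : Rep.{u} k (End c)} (e : A ⟶ B)
    (he : Function.Surjective e.hom) (hst : ∀ f : d ⟶ c, UnitFinite k (leftStabiliser f))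
    (b : (d ⟶ c) → B.V)
    (hb : ∀ (f : d ⟶ c) (g : End c), b (f ≫ (show c ⟶ c from g)) = B.ρ g (b f)) :
    ∃ a : (d ⟶ c) → A.V,
      (∀ (f : d ⟶ c) (g : End c), a (f ≫ (show c ⟶ c from g)) = A.ρ g (a f)) ∧
      ∀ f, e.hom (a f) = b f := by
  have h1 : ∀ f : d ⟶ c, ∃ a : A.V, e.hom a = b f ∧
      ∀ g : End c, f ≫ (show c ⟶ c from g) = f → A.ρ g a = a := by
    intro f
    obtain ⟨a, ha⟩ := he (b f)
    obtain ⟨a', ha', hinv⟩ := (hst f).exists_invariant (fun h => A.ρ h.1)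
      (fun g h a => by rw [Subgroup.coe_mul, map_mul]; rfl) e.hom.toLinearMap (b f) a fun h => by
        refine (Rep.hom_comm_apply e h.1 a).trans ?_
        rw [ha, ← hb, show f ≫ (show c ⟶ c from h.1) = f from h.2]
    exact ⟨a', ha', fun g hg => hinv ⟨g, hg⟩⟩
  choose a ha hinv using h1
  let S : Setoid (d ⟶ c) :=
    { r f f' := ∃ g : c ⟶ c, f ≫ g = f'
      iseqv :=
        { refl f := ⟨𝟙 c, Category.comp_id f⟩
          symm := by
            rintro f _ ⟨g, rfl⟩
            have := isIso_of_endo g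
            exact ⟨inv g, by simp⟩
          trans := by
            rintro f _ _ ⟨g, rfl⟩ ⟨g', rfl⟩
            exact ⟨g ≫ g', by simp⟩ } }
  let r : (d ⟶ c) → (d ⟶ c) := fun f => Quotient.out (s := S) (Quotient.mk S f)
  have hr : ∀ f, ∃ g : c ⟶ c, r f ≫ g = f := fun f =>
    Quotient.exact (s := S) (Quotient.out_eq (s := S) (Quotient.mk S f))
  have hr' : ∀ f (g : c ⟶ c), r (f ≫ g) = r f := fun f g =>
    congrArg (Quotient.out (s := S)) (Quotient.sound (S.iseqv.symm ⟨g, rfl⟩))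
  choose γ hγ using hr
  refine ⟨fun f => A.ρ (show End c from γ f) (a (r f)), fun f g => ?_, fun f => ?_⟩
  · have := isIso_of_endo (γ f ≫ (show c ⟶ c from g))
    -- The chosen `γ` is not multiplicative. The discrepancy between `γ (f ≫ g)` and `γ f ≫ g`
    -- stabilises `r f`, so it fixes `a (r f)`.
    have h2 : A.ρ (show End c from γ (f ≫ g) ≫ inv (γ f ≫ (show c ⟶ c from g))) (a (r f)) =
        a (r f) := by
      apply hinv
      change r f ≫ γ (f ≫ g) ≫ inv (γ f ≫ (show c ⟶ c from g)) = r f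
      rw [← Category.assoc, IsIso.comp_inv_eq, ← hr' f g, hγ, hr', reassoc_of% hγ f]
    change A.ρ (show End c from γ (f ≫ (show c ⟶ c from g))) (a (r (f ≫ (show c ⟶ c from g)))) =
      A.ρ g (A.ρ (show End c from γ f) (a (r f)))
    rw [hr']
    conv_rhs => rw [← h2]
    simp only [← Module.End.mul_apply, ← map_mul]
    congr 2
    change γ (f ≫ g) = ((γ (f ≫ g) ≫ inv (γ f ≫ (show c ⟶ c from g))) ≫
      γ f) ≫ (show c ⟶ c from g)
    simp
  · rw [Rep.hom_comm_apply, ha, ← hb]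
    exact congrArg b (hγ f)

/-- Evaluation at `c` is left adjoint to coinduction, so a lifting problem for `evRep M c`
transposes to one for `M`. Coinduction need only preserve surjectivity at objects where `M` is
nonzero. This weak form of the hypothesis lets `Hereditary.hereditary_rep` use the lemma without any
finiteness of stabilisers. -/
theorem evRep_projective {M : LeftMod k C} (hM : Projective M) (c : C)
    (hst : ∀ (d : C) (f : d ⟶ c), (∃ x : M.obj d, x ≠ 0) → UnitFinite k (leftStabiliser f)) :
    Projective (evRep M c) where
  factors {A B} φ e he := by
    rw [Rep.epi_iff_surjective] at he
    let E : coind A ⟶ coind B := LeftMod.homMk (fun d =>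
      { toFun n := ⟨fun h => e.hom (n.1 h), fun f g =>
          (congrArg e.hom (n.2 f g)).trans (Rep.hom_comm_apply _ _ _)⟩
        map_add' n n' := Subtype.ext (funext fun h => map_add e.hom _ _)
        map_smul' r n := Subtype.ext (funext fun h => map_smul e.hom _ _) }) fun _ _ => rfl
    let Φ : M ⟶ coind B := LeftMod.homMk (fun d =>
      { toFun x := ⟨fun h => φ.hom ((M.map h).hom x : M.obj c), fun f g =>
          (congrArg φ.hom (LeftMod.map_comp_apply M f (show c ⟶ c from g) x)).trans
            (Rep.hom_comm_apply φ g ((M.map f).hom x))⟩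
        map_add' x y := Subtype.ext (funext fun h =>
          (congrArg φ.hom (map_add (M.map h).hom x y)).trans (map_add φ.hom _ _))
        map_smul' r x := Subtype.ext (funext fun h =>
          (congrArg φ.hom (map_smul (M.map h).hom r x)).trans (map_smul φ.hom _ _)) })
      fun f x => Subtype.ext (funext fun h => congrArg φ.hom (M.map_comp_apply f h x).symm)
    obtain ⟨Ψ, hΨ⟩ := LeftMod.exists_lift_of_range hM E Φ fun d x => by
      by_cases hx : x = 0
      · exact ⟨0, by rw [hx, map_zero, map_zero]⟩
      · obtain ⟨a, ha, ha'⟩ := coind_lift (d := d) e he (fun f => hst d f ⟨x, hx⟩)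
          ((Φ.app d).hom x).1 ((Φ.app d).hom x).2
        exact ⟨⟨a, ha⟩, Subtype.ext (funext ha')⟩
    let ψ : evRep M c ⟶ A := Rep.ofHom (ρ := (evRep M c).ρ) (σ := A.ρ)
      (LinearMap.intertwiningMap_of_isIntertwiningMap _ _
        { toFun x := ((Ψ.app c).hom x).1 (𝟙 c)
          map_add' x y := congrArg (fun n => n.1 (𝟙 c)) (map_add (Ψ.app c).hom x y)
          map_smul' r x := congrArg (fun n => n.1 (𝟙 c)) (map_smul (Ψ.app c).hom r x) } fun g x => by
        have h1 := LeftMod.naturality_apply Ψ (show c ⟶ c from g) x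
        refine (congrArg (fun n => n.1 (𝟙 c)) h1).trans ?_
        refine Eq.trans ?_ (((Ψ.app c).hom x).2 (𝟙 c) g)
        change ((Ψ.app c).hom x).1 ((show c ⟶ c from g) ≫ 𝟙 c) = _
        rw [Category.comp_id, Category.id_comp])
    refine ⟨ψ, Rep.hom_ext (Representation.IntertwiningMap.ext (LinearMap.ext fun x => ?_))⟩
    have h1 := congrArg (fun t => ((t.app c).hom x).1 (𝟙 c)) hΨ
    refine h1.trans ?_
    exact congrArg φ.hom (M.map_id_apply x)

/-- A submodule of a left module. -/
def LeftMod.sub (M : LeftMod k C) (S : ∀ d, Submodule k (M.obj d))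
    (hS : ∀ {d d' : C} (f : d ⟶ d') (x : M.obj d), x ∈ S d → (M.map f).hom x ∈ S d') :
    LeftMod k C where
  obj d := ModuleCat.of k (S d)
  map f := ModuleCat.ofHom ((M.map f).hom.restrict fun x hx => hS f x hx)
  map_id d := by
    exact ModuleCat.hom_ext (LinearMap.ext fun x => Subtype.ext (M.map_id_apply x.1))
  map_comp f g := by
    exact ModuleCat.hom_ext (LinearMap.ext fun x => Subtype.ext (M.map_comp_apply f g x.1))

theorem leftStabiliser_unitFinite_of_isIso {d c : C} (f : d ⟶ c) (hf : IsIso f) :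
    UnitFinite k (leftStabiliser f) := by
  have : Subsingleton (leftStabiliser f) := by
    refine ⟨fun a b => Subtype.ext ?_⟩
    have h : f ≫ (show c ⟶ c from a.1) = f ≫ (show c ⟶ c from b.1) := a.2.trans b.2.symm
    exact (cancel_epi f).1 h
  refine ⟨inferInstance, ?_⟩
  rw [Nat.card_of_subsingleton 1]
  simp

/-- A subrepresentation of a projective embeds in the value at `c` of a free module `F` generated at
`c`. It is the value at `c` of a submodule of `F`, which is projective. As `F` vanishes at every
source of a non-invertible morphism to `c`, only trivial stabilisers matter for evaluation. -/
theorem Hereditary.hereditary_rep (hA : Hereditary (LeftMod k C)) (c : C) :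
    Hereditary (Rep.{u} k (End c)) := by
  intro Q P i hi hP
  let F : LeftMod k C := freeOn k fun _ : P.V => c
  let p : evRep F c ⟶ P := Rep.ofHom (ρ := (evRep F c).ρ) (σ := P.ρ)
    (LinearMap.intertwiningMap_of_isIntertwiningMap _ _
      (freeLift c fun (v : P.V) g => P.ρ (show End c from g) v) fun g x => by
        have h1 : freeLift c (fun (v : P.V) g => P.ρ (show End c from g) v) ∘ₗ
            (F.map (show c ⟶ c from g)).hom =
            P.ρ g ∘ₗ freeLift c fun (v : P.V) g => P.ρ (show End c from g) v := by
          refine freeOn_lhom_ext fun v a => ?_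
          simp only [LinearMap.comp_apply, F, freeOn_map_single, freeLift_single]
          rw [← Module.End.mul_apply, ← map_mul]
          rfl
        exact LinearMap.congr_fun h1 x)
  have hp : Epi p := by
    rw [Rep.epi_iff_surjective]
    intro v
    refine ⟨freeSingle k _ v (𝟙 c), (freeLift_single _ _ _).trans ?_⟩
    change P.ρ 1 v = v
    rw [map_one]
    rfl
  let s : P ⟶ evRep F c := Projective.factorThru (𝟙 P) p
  have hs : s ≫ p = 𝟙 P := Projective.factorThru_comp _ _
  have hsm : Mono s := mono_of_mono_fac hs
  let j : Q ⟶ evRep F c := i ≫ s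
  have hj : Function.Injective j.hom := (Rep.mono_iff_injective _).1 (mono_comp i s)
  let R : Submodule k (F.obj c) := LinearMap.range j.hom.toLinearMap
  -- The largest submodule of `F` with value `R` at `c`: for `d` not isomorphic to `c` the infimum
  -- is empty and `S d` is everything.
  let S : ∀ d, Submodule k (F.obj d) := fun d =>
    ⨅ (h : d ⟶ c) (_ : IsIso h), R.comap (F.map h).hom
  have hSmem : ∀ {d} (x : F.obj d), x ∈ S d ↔ ∀ h : d ⟶ c, IsIso h → (F.map h).hom x ∈ R := by
    intro d x
    simp [S, Submodule.mem_iInf]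
  have hvan : ∀ {d} (h : d ⟶ c), ¬ IsIso h → ∀ x : F.obj d, x = 0 := fun h hh x =>
    freeOn_subsingleton (fun _ => ⟨fun a => hh (isIso_of_hom_hom h a)⟩) x
  have hS : ∀ {d d' : C} (f : d ⟶ d') (x : F.obj d), x ∈ S d → (F.map f).hom x ∈ S d' := by
    intro d d' f x hx
    rw [hSmem] at hx ⊢
    intro h hh
    rw [← LeftMod.map_comp_apply]
    by_cases hf : IsIso (f ≫ h)
    · exact hx _ hf
    · rw [hvan _ hf x, map_zero]
      exact zero_mem R
  let Q' : LeftMod k C := F.sub S hS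
  let ι : Q' ⟶ F := LeftMod.homMk (fun d => (S d).subtype) fun _ _ => rfl
  have hQ' : Projective Q' := hA ι
    ((LeftMod.mono_iff _).2 fun d => Subtype.val_injective) (freeOn_projective _)
  have hev : Projective (evRep Q' c) := by
    refine evRep_projective hQ' c ?_
    rintro d f ⟨x, hx⟩
    by_cases hf : IsIso f
    · exact leftStabiliser_unitFinite_of_isIso f hf
    · exact (hx (Subtype.ext (hvan f hf x.1))).elim
  have hScR : S c = R := by
    ext x
    rw [hSmem]
    constructor
    · intro h
      have := h (𝟙 c) inferInstance
      rwa [LeftMod.map_id_apply] at this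
    · rintro ⟨q, rfl⟩ h -
      exact ⟨Q.ρ (show End c from h) q, Rep.hom_comm_apply j _ _⟩
  let θ : Q ⟶ evRep Q' c := Rep.ofHom (ρ := Q.ρ) (σ := (evRep Q' c).ρ)
    (LinearMap.intertwiningMap_of_isIntertwiningMap _ _
      (j.hom.toLinearMap.codRestrict (S c) fun q => by
        rw [hScR]
        exact LinearMap.mem_range_self _ q) fun g x => Subtype.ext (Rep.hom_comm_apply j g x))
  have h1 : Mono θ := by
    rw [Rep.mono_iff_injective]
    intro a b hab
    exact hj (congrArg Subtype.val hab)
  have h2 : Epi θ := by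
    rw [Rep.epi_iff_surjective]
    rintro ⟨x, hx⟩
    obtain ⟨q, hq⟩ : x ∈ R := hScR ▸ hx
    exact ⟨q, Subtype.ext hq⟩
  have h3 : IsIso θ := isIso_of_mono_of_epi θ
  exact Projective.of_iso (asIso θ).symm hev

end

/-! ### Factorisations, and derivations determined by unfactorisable morphisms. -/

section Generation

variable (C : Type u) [SmallCategory C]

/-- The morphisms that are compositions of an isomorphism and unfactorisable morphisms. -/
inductive Built : ∀ {x y : C}, (x ⟶ y) → Prop
  | iso {x y : C} (f : x ⟶ y) (hf : IsIso f) : Built f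
  | snoc {x y z : C} (f : x ⟶ y) (α : y ⟶ z) (hα : Unfactorisable α) (hf : Built f) :
      Built (f ≫ α)

/-- Two factorisations of a morphism with unfactorisable last factor are isomorphic. -/
def UniqueLastFactor : Prop :=
  ∀ {x y z z' : C} (u : x ⟶ z) (α : z ⟶ y) (u' : x ⟶ z') (α' : z' ⟶ y), Unfactorisable α →
    Unfactorisable α' → u ≫ α = u' ≫ α' → ∃ h : z ≅ z', u ≫ h.hom = u' ∧ h.hom ≫ α' = α

end Generation

section

variable {k : Type u} [CommRing k] {C : Type u} [SmallCategory C]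

/-- Extension of `D` from the unfactorisable morphisms to a derivation. -/
inductive ExtDer {P N : LeftMod k C} (D : ∀ ⦃x y : C⦄, (x ⟶ y) → P.obj x →ₗ[k] N.obj y) :
    ∀ {x y : C}, (x ⟶ y) → (P.obj x →ₗ[k] N.obj y) → Prop
  | iso {x y : C} (f : x ⟶ y) (hf : IsIso f) : ExtDer D f 0
  | snoc {x y z : C} (f : x ⟶ y) (α : y ⟶ z) (hα : Unfactorisable α) (d : P.obj x →ₗ[k] N.obj y)
      (hd : ExtDer D f d) :
      ExtDer D (f ≫ α) ((N.map α).hom ∘ₗ d + D α ∘ₗ (P.map f).hom)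

namespace ExtDer

variable {P N : LeftMod k C} {D : ∀ ⦃x y : C⦄, (x ⟶ y) → P.obj x →ₗ[k] N.obj y}

theorem inversion {x y : C} {f : x ⟶ y} {d : P.obj x →ₗ[k] N.obj y} (h : ExtDer D f d) :
    (IsIso f ∧ d = 0) ∨ ∃ (z : C) (u : x ⟶ z) (α : z ⟶ y) (d' : P.obj x →ₗ[k] N.obj z),
      Unfactorisable α ∧ ExtDer D u d' ∧ f = u ≫ α ∧
        d = (N.map α).hom ∘ₗ d' + D α ∘ₗ (P.map u).hom := by
  cases h with
  | iso f hf => exact Or.inl ⟨hf, rfl⟩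
  | snoc f α hα d hd => exact Or.inr ⟨_, f, α, d, hα, hd, rfl, rfl⟩

theorem exists_of_built {x y : C} {f : x ⟶ y} (h : Built C f) : ∃ d, ExtDer D f d := by
  induction h with
  | iso f hf => exact ⟨0, .iso f hf⟩
  | snoc f α hα _ ih =>
    obtain ⟨d, hd⟩ := ih
    exact ⟨_, .snoc f α hα d hd⟩

theorem of_unfactorisable {x y : C} (α : x ⟶ y) (hα : Unfactorisable α) :
    ExtDer D α (D α) := by
  have h := ExtDer.snoc (D := D) (𝟙 x) α hα 0 (.iso _ inferInstance)
  rw [LinearMap.comp_zero, zero_add, Category.id_comp, P.map_id, ModuleCat.hom_id,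
    LinearMap.comp_id] at h
  exact h

theorem comp_eq_zero {N' : LeftMod k C} (e : N ⟶ N')
    (hD : ∀ {x y : C} (α : x ⟶ y), Unfactorisable α → ∀ p, (e.app y).hom (D α p) = 0)
    {x y : C} {f : x ⟶ y} {d : P.obj x →ₗ[k] N.obj y} (h : ExtDer D f d) (p : P.obj x) :
    (e.app y).hom (d p) = 0 := by
  induction h with
  | iso f hf => rw [LinearMap.zero_apply, map_zero]
  | snoc f α hα d _ ih =>
    rw [LinearMap.add_apply, map_add, LinearMap.comp_apply, LinearMap.comp_apply,
      LeftMod.naturality_apply, ih, map_zero, hD α hα, add_zero]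

variable [EICategory C]
  (hD : ∀ {x y z : C} (α : x ⟶ y) (h : y ⟶ z), Unfactorisable α → IsIso h →
    D (α ≫ h) = (N.map h).hom ∘ₗ D α)

include hD in
theorem comp_iso {x y z : C} {f : x ⟶ y} {d : P.obj x →ₗ[k] N.obj y} (hf : ExtDer D f d)
    (h : y ⟶ z) (hh : IsIso h) : ExtDer D (f ≫ h) ((N.map h).hom ∘ₗ d) := by
  cases hf with
  | iso f hf =>
    rw [LinearMap.comp_zero]
    exact .iso _ inferInstance
  | snoc f α hα d hd =>
    have := ExtDer.snoc f (α ≫ h) (hα.comp_iso h) d hd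
    rw [hD α h hα hh, N.map_comp, ModuleCat.hom_comp] at this
    rw [Category.assoc, LinearMap.comp_add]
    exact this

include hD in
theorem leibniz {x y z : C} {f : x ⟶ y} {d : P.obj x →ₗ[k] N.obj y} (hf : ExtDer D f d)
    {g : y ⟶ z} {d' : P.obj y →ₗ[k] N.obj z} (hg : ExtDer D g d') :
    ExtDer D (f ≫ g) ((N.map g).hom ∘ₗ d + d' ∘ₗ (P.map f).hom) := by
  induction hg with
  | iso g hg =>
    rw [LinearMap.zero_comp, add_zero]
    exact hf.comp_iso hD g hg
  | snoc u α hα d' _ ih =>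
    have := ExtDer.snoc _ α hα _ ih
    rw [Category.assoc] at this
    convert this using 1
    ext p
    simp [add_assoc]

include hD in
-- Uniqueness of the last factor says that two factorisations differ by an isomorphism in the
-- middle. Equivariance of `D` on both sides of it makes the two values agree, so the relation
-- `ExtDer D` is a function.
theorem unique (hU : UniqueLastFactor C)
    (hD' : ∀ {x y z : C} (h : x ⟶ y) (α : y ⟶ z), Unfactorisable α → IsIso h →
      D (h ≫ α) = D α ∘ₗ (P.map h).hom)
    {x y : C} {f : x ⟶ y} {d : P.obj x →ₗ[k] N.obj y} (hf : ExtDer D f d)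
    {d' : P.obj x →ₗ[k] N.obj y} (hf' : ExtDer D f d') : d = d' := by
  induction hf with
  | iso f hf =>
    obtain ⟨-, h⟩ | ⟨z, u, α, d'', hα, -, rfl, -⟩ := hf'.inversion
    · exact h.symm
    · exact (hα.1 (isIso_right_of_comp u α hf)).elim
  | snoc f α hα d _ ih =>
    obtain ⟨hi, -⟩ | ⟨z, u, α', d'', hα', hd'', heq, rfl⟩ := hf'.inversion
    · exact (hα.1 (isIso_right_of_comp f α hi)).elim
    · obtain ⟨h, rfl, rfl⟩ := hU f α u α' hα hα' heq
      have h1 := hd''.comp_iso hD h.inv inferInstance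
      rw [Category.assoc, h.hom_inv_id, Category.comp_id] at h1
      rw [ih h1, hD' h.hom α' hα' inferInstance]
      ext p
      simp only [LinearMap.add_apply, LinearMap.comp_apply, LeftMod.map_comp_apply]
      rw [← LeftMod.map_comp_apply N h.inv h.hom, h.inv_hom_id, LeftMod.map_id_apply]

end ExtDer

end

/-! ### Sufficiency: extending derivations and correcting lifts. -/

section Hereditary

variable {k : Type u} [CommRing k] {C : Type u} [SmallCategory C]

/-- The extension of a left module `P` by `N` given by a derivation. -/
def twisted {P N : LeftMod k C} (D : ∀ ⦃x y : C⦄, (x ⟶ y) → P.obj x →ₗ[k] N.obj y)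
    (h1 : ∀ x, D (𝟙 x) = 0)
    (h2 : ∀ {x y z : C} (f : x ⟶ y) (g : y ⟶ z),
      D (f ≫ g) = (N.map g).hom ∘ₗ D f + D g ∘ₗ (P.map f).hom) : LeftMod k C where
  obj c := ModuleCat.of k (N.obj c × P.obj c)
  map f := ModuleCat.ofHom (LinearMap.prod
    (LinearMap.coprod (N.map f).hom (D f)) ((P.map f).hom ∘ₗ LinearMap.snd k _ _))
  map_id c := by
    refine ModuleCat.hom_ext (LinearMap.ext fun p => Prod.ext ?_ ?_)
    · change (N.map (𝟙 c)).hom p.1 + D (𝟙 c) p.2 = p.1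
      rw [h1, LeftMod.map_id_apply, LinearMap.zero_apply, add_zero]
    · exact LeftMod.map_id_apply P p.2
  map_comp f g := by
    refine ModuleCat.hom_ext (LinearMap.ext fun p => Prod.ext ?_ ?_)
    · change (N.map (f ≫ g)).hom p.1 + D (f ≫ g) p.2 =
        (N.map g).hom ((N.map f).hom p.1 + D f p.2) + D g ((P.map f).hom p.2)
      rw [h2, LeftMod.map_comp_apply, map_add, LinearMap.add_apply, add_assoc]
      rfl
    · exact LeftMod.map_comp_apply P f g p.2

/-- Derivations with values in a module are inner on projective modules. -/
theorem exists_inner_of_projective {P N : LeftMod k C} (hP : Projective P)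
    (D : ∀ ⦃x y : C⦄, (x ⟶ y) → P.obj x →ₗ[k] N.obj y) (h1 : ∀ x, D (𝟙 x) = 0)
    (h2 : ∀ {x y z : C} (f : x ⟶ y) (g : y ⟶ z),
      D (f ≫ g) = (N.map g).hom ∘ₗ D f + D g ∘ₗ (P.map f).hom) :
    ∃ δ : ∀ c, P.obj c →ₗ[k] N.obj c, ∀ {x y : C} (f : x ⟶ y) (p : P.obj x),
      δ y ((P.map f).hom p) = (N.map f).hom (δ x p) + D f p := by
  let pr : twisted D h1 h2 ⟶ P := LeftMod.homMk (fun c => LinearMap.snd k _ _) fun _ _ => rfl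
  have hpr : Epi pr := (LeftMod.epi_iff pr).2 fun c => Prod.snd_surjective
  -- A section of the extension defined by `D`; its component in `N` is the required `δ`, and
  -- naturality of the section is the inner derivation formula.
  let s : P ⟶ twisted D h1 h2 := Projective.factorThru (𝟙 P) pr
  have hs : s ≫ pr = 𝟙 P := Projective.factorThru_comp _ _
  have hs' : ∀ c p, ((s.app c).hom p).2 = p := fun c p =>
    congrArg (fun t => (t.app c).hom p) hs
  refine ⟨fun c => LinearMap.fst k (N.obj c) (P.obj c) ∘ₗ (s.app c).hom, fun {x y} f p => ?_⟩
  have h3 := congrArg Prod.fst (LeftMod.naturality_apply s f p)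
  refine h3.trans ?_
  change (N.map f).hom ((s.app x).hom p).1 + D f ((s.app x).hom p).2 = _
  rw [hs']
  rfl

theorem leftStabiliser_unitFinite [EICategory C] {c d : C} (f : c ⟶ d)
    (h : UnitFinite k (MulAction.stabilizer (End d × (End c)ᵐᵒᵖ) f)) :
    UnitFinite k (leftStabiliser f) := by
  refine h.of_injective
    { toFun g := ⟨(g.1, 1), (Category.id_comp _).trans g.2⟩
      map_one' := rfl
      map_mul' a b := Subtype.ext (Prod.ext rfl (mul_one _).symm) } fun a b hab => ?_
  exact Subtype.ext (congrArg (fun t => t.1.1) hab)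

/-- An automorphism of an arrow becomes an element of the biset stabiliser when its source component
is inverted. -/
theorem arrowAut_unitFinite [EICategory C] {w : Arrow C}
    (h : UnitFinite k (MulAction.stabilizer (End w.right × (End w.left)ᵐᵒᵖ) w.hom)) :
    UnitFinite k (Aut w) := by
  refine h.of_injective
    { toFun φ := ⟨((show End w.right from φ.hom.right),
          MulOpposite.op (show End w.left from φ.inv.left)), by
        change φ.inv.left ≫ w.hom ≫ φ.hom.right = w.hom
        rw [← Arrow.w φ.hom, ← Category.assoc, ← Arrow.comp_left, φ.inv_hom_id, Arrow.id_left,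
          Category.id_comp]⟩
      map_one' := rfl
      map_mul' a b := rfl } fun a b hab => ?_
  have h1 : a.hom.right = b.hom.right := congrArg (fun t => t.1.1) hab
  have h2 : a.inv.left = b.inv.left := congrArg (fun t => t.1.2.unop) hab
  refine Iso.ext (Arrow.hom_ext _ _ ?_ h1)
  have h3 : a.hom.left ≫ b.inv.left = 𝟙 _ := by
    rw [← h2, ← Arrow.comp_left, a.hom_inv_id, Arrow.id_left]
  have h4 : b.inv.left ≫ b.hom.left = 𝟙 _ := by
    rw [← Arrow.comp_left, b.inv_hom_id, Arrow.id_left]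
  calc a.hom.left = a.hom.left ≫ b.inv.left ≫ b.hom.left := by rw [h4, Category.comp_id]
    _ = b.hom.left := by rw [← Category.assoc, h3, Category.id_comp]

/-- Lifts that are natural with respect to isomorphisms. -/
theorem exists_iso_natural_lift {Q N N' : LeftMod k C}
    (hQ : ∀ c, Projective (evRep Q c)) (e : N ⟶ N') (he : Epi e) (φ : Q ⟶ N') :
    ∃ g : ∀ c, Q.obj c →ₗ[k] N.obj c, (∀ c q, (e.app c).hom (g c q) = (φ.app c).hom q) ∧
      ∀ {c d : C} (h : c ⟶ d) (_ : IsIso h) (q : Q.obj c),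
        g d ((Q.map h).hom q) = (N.map h).hom (g c q) := by
  rw [LeftMod.epi_iff] at he
  have hrep : ∀ c, ∃ g : Q.obj c →ₗ[k] N.obj c, (∀ q, (e.app c).hom (g q) = (φ.app c).hom q) ∧
      ∀ (h : c ⟶ c) (q : Q.obj c), g ((Q.map h).hom q) = (N.map h).hom (g q) := by
    intro c
    have := hQ c
    let ev : ∀ {A B : LeftMod k C} (η : A ⟶ B), evRep A c ⟶ evRep B c := fun {A B} η =>
      Rep.ofHom (ρ := (evRep A c).ρ) (σ := (evRep B c).ρ)
        (LinearMap.intertwiningMap_of_isIntertwiningMap _ _ (η.app c).hom fun g x =>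
          LeftMod.naturality_apply η (show c ⟶ c from g) x)
    have : Epi (ev e) := (Rep.epi_iff_surjective _).2 (he c)
    let l := Projective.factorThru (ev φ) (ev e)
    have hl : l ≫ ev e = ev φ := Projective.factorThru_comp _ _
    exact ⟨l.hom.toLinearMap, fun q => congrArg (fun t => t.hom q) hl, fun h q =>
      Rep.hom_comm_apply l (show End c from h) q⟩
  obtain ⟨g, hg, hg'⟩ := exists_iso_invariant_family (W := C)
    (fun c => Q.obj c →ₗ[k] N.obj c)
    (fun {a b} h m => (N.map h.hom).hom ∘ₗ m ∘ₗ (Q.map h.inv).hom)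
    (fun φ ψ m => by ext q; simp)
    (fun c m => ∀ q, (e.app c).hom (m q) = (φ.app c).hom q)
    (fun {a b} h m hm q => by
      simp only [LinearMap.comp_apply]
      rw [LeftMod.naturality_apply, hm, LeftMod.naturality_apply, ← LeftMod.map_comp_apply,
        h.inv_hom_id, LeftMod.map_id_apply])
    (fun c => by
      obtain ⟨m, hm, hm'⟩ := hrep c
      refine ⟨m, hm, fun h => LinearMap.ext fun q => ?_⟩
      simp only [LinearMap.comp_apply]
      rw [← hm', ← LeftMod.map_comp_apply, h.inv_hom_id, LeftMod.map_id_apply])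
  refine ⟨g, hg, fun {c d} h hh q => ?_⟩
  rw [← hg' (asIso h)]
  simp only [LinearMap.comp_apply]
  rw [← LeftMod.map_comp_apply, asIso_inv, IsIso.hom_inv_id, LeftMod.map_id_apply, asIso_hom]

/-- Equivariant extension of families of linear maps indexed by unfactorisable morphisms. -/
theorem exists_equivariant_extension [EICategory C] [IsSemisimpleRing k] {Q P N N' : LeftMod k C} (i : Q ⟶ P)
    (hi : Mono i) (e : N ⟶ N')
    (hst : ∀ {c d : C} (f : c ⟶ d), ¬ IsIso f →
      UnitFinite k (MulAction.stabilizer (End d × (End c)ᵐᵒᵖ) f))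
    (D : ∀ ⦃x y : C⦄, (x ⟶ y) → Q.obj x →ₗ[k] N.obj y)
    (hDe : ∀ {x y : C} (f : x ⟶ y) (q : Q.obj x), (e.app y).hom (D f q) = 0)
    (hD : ∀ {x y x' y' : C} (f : x ⟶ y) (h : x' ⟶ x) (h' : y ⟶ y'), IsIso h → IsIso h' →
      D (h ≫ f ≫ h') = (N.map h').hom ∘ₗ D f ∘ₗ (Q.map h).hom) :
    ∃ D' : ∀ ⦃x y : C⦄, (x ⟶ y) → P.obj x →ₗ[k] N.obj y,
      (∀ {x y : C} (f : x ⟶ y), Unfactorisable f → ∀ q, D' f ((i.app x).hom q) = D f q) ∧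
      (∀ {x y : C} (f : x ⟶ y), Unfactorisable f → ∀ p, (e.app y).hom (D' f p) = 0) ∧
      ∀ {x y x' y' : C} (f : x ⟶ y) (h : x' ⟶ x) (h' : y ⟶ y'), IsIso h → IsIso h' →
        D' (h ≫ f ≫ h') = (N.map h').hom ∘ₗ D' f ∘ₗ (P.map h).hom := by
  rw [LeftMod.mono_iff] at hi
  have hiso : ∀ {a b : Arrow C} (φ : a ≅ b), φ.inv.left ≫ a.hom ≫ φ.hom.right = b.hom := by
    intro a b φ
    rw [← Arrow.w φ.hom, ← Category.assoc, ← Arrow.comp_left, φ.inv_hom_id, Arrow.id_left,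
      Category.id_comp]
  let act : ∀ {a b : Arrow C}, (a ≅ b) → (P.obj a.left →ₗ[k] N.obj a.right) →
      (P.obj b.left →ₗ[k] N.obj b.right) := fun {a b} φ m =>
    (N.map φ.hom.right).hom ∘ₗ m ∘ₗ (P.map φ.inv.left).hom
  have act_trans : ∀ {a b c : Arrow C} (φ : a ≅ b) (ψ : b ≅ c)
      (m : P.obj a.left →ₗ[k] N.obj a.right), act (φ ≪≫ ψ) m = act ψ (act φ m) := by
    intro a b c φ ψ m
    ext q
    simp [act]
  -- The condition is void at other arrows, where the value `0` will serve; being unfactorisable is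
  -- invariant under isomorphism of arrows.
  let X : ∀ w : Arrow C, (P.obj w.left →ₗ[k] N.obj w.right) → Prop := fun w m =>
    Unfactorisable w.hom → (∀ q, m ((i.app w.left).hom q) = D w.hom q) ∧
      ∀ p, (e.app w.right).hom (m p) = 0
  have hX : ∀ {a b : Arrow C} (φ : a ≅ b) (m), X a m → X b (act φ m) := by
    intro a b φ m hm hb
    have ha : Unfactorisable a.hom := by
      rw [← hiso φ.symm]
      exact Unfactorisable.iso_comp (Unfactorisable.comp_iso hb _) _
    obtain ⟨h1, h2⟩ := hm ha
    refine ⟨fun q => ?_, fun p => ?_⟩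
    · simp only [act, LinearMap.comp_apply]
      rw [← LeftMod.naturality_apply, h1, ← hiso φ, hD _ _ _ inferInstance inferInstance]
      rfl
    · simp only [act, LinearMap.comp_apply]
      rw [LeftMod.naturality_apply, h2, map_zero]
  obtain ⟨s, hs, hs'⟩ := exists_iso_invariant_family (W := Arrow C) _ act
    act_trans X hX (fun w => by
      by_cases hw : Unfactorisable w.hom
      -- Semisimplicity of `k` provides a linear retraction of `i`, and so an extension that need
      -- not be equivariant.
      · obtain ⟨r, hr⟩ := IsSemisimpleModule.extension_property (i.app w.left).hom (hi _)
          LinearMap.id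
        have hr' : ∀ q, r ((i.app w.left).hom q) = q := LinearMap.congr_fun hr
        have hX0 : X w (D w.hom ∘ₗ r) := fun _ =>
          ⟨fun q => by rw [LinearMap.comp_apply, hr'], fun p => hDe _ _⟩
        obtain ⟨m, hm, hm'⟩ := (arrowAut_unitFinite (hst w.hom hw.1)).exists_invariant
          (H := Aut w) (A := P.obj w.left →ₗ[k] N.obj w.right)
          (B := (Q.obj w.left →ₗ[k] N.obj w.right) × (P.obj w.left →ₗ[k] N'.obj w.right))
          (fun φ =>
            { toFun m := act φ m
              map_add' m m' := by ext p; simp [act]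
              map_smul' r m := by ext p; simp [act] })
          (fun φ ψ m => (act_trans ψ φ m).symm)
          -- Both requirements, extending `D` and landing in the kernel of `e`, are one linear
          -- equation with values in a product, so a single average preserves them.
          ({ toFun m := (m ∘ₗ (i.app w.left).hom, (e.app w.right).hom ∘ₗ m)
             map_add' m m' := by ext p <;> simp
             map_smul' r m := by ext p <;> simp })
          (D w.hom, 0) (D w.hom ∘ₗ r) (fun φ => by
            obtain ⟨h1, h2⟩ := hX φ _ hX0 hw
            exact Prod.ext (LinearMap.ext h1) (LinearMap.ext h2))
        refine ⟨m, fun _ => ⟨fun q => ?_, fun p => ?_⟩, hm'⟩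
        · exact LinearMap.congr_fun (congrArg Prod.fst hm) q
        · exact LinearMap.congr_fun (congrArg Prod.snd hm) p
      · exact ⟨0, fun h => (hw h).elim, fun φ => by ext p; simp [act]⟩)
  refine ⟨fun _ _ f => s (Arrow.mk f), fun f hf => (hs (Arrow.mk f) hf).1,
    fun f hf => (hs (Arrow.mk f) hf).2, fun {x y x' y'} f h h' hh hh' => ?_⟩
  have := hs' (a := Arrow.mk f) (b := Arrow.mk (h ≫ f ≫ h'))
    (Arrow.isoMk (asIso h).symm (asIso h') (by simp))
  exact this.symm

/-- Sufficient conditions for left modules to be hereditary. -/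
theorem hereditary_leftMod [EICategory C] [IsSemisimpleRing k] (hB : ∀ {x y : C} (f : x ⟶ y), Built C f)
    (hU : UniqueLastFactor C) (hG : ∀ c : C, Hereditary (Rep.{u} k (End c)))
    (hst : ∀ {c d : C} (f : c ⟶ d), ¬ IsIso f →
      UnitFinite k (MulAction.stabilizer (End d × (End c)ᵐᵒᵖ) f)) :
    Hereditary (LeftMod k C) := by
  intro Q P i hi hP
  refine ⟨fun {N N'} φ e he => ?_⟩
  have hPc : ∀ c, Projective (evRep P c) := fun c => evRep_projective hP c fun d f _ => by
    by_cases hf : IsIso f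
    · exact leftStabiliser_unitFinite_of_isIso f hf
    · exact leftStabiliser_unitFinite f (hst f hf)
  have hQc : ∀ c, Projective (evRep Q c) := fun c => by
    let ic : evRep Q c ⟶ evRep P c := Rep.ofHom (ρ := (evRep Q c).ρ) (σ := (evRep P c).ρ)
      (LinearMap.intertwiningMap_of_isIntertwiningMap _ _ (i.app c).hom fun g x =>
        LeftMod.naturality_apply i (show c ⟶ c from g) x)
    exact hG c ic ((Rep.mono_iff_injective _).2 ((LeftMod.mono_iff i).1 hi c)) (hPc c)
  obtain ⟨g, hg, hg'⟩ := exists_iso_natural_lift hQc e he φ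
  -- The failure of `g` to be natural; it takes values in the kernel of `e` because `e ∘ g = φ` is
  -- natural.
  let D0 : ∀ ⦃x y : C⦄, (x ⟶ y) → Q.obj x →ₗ[k] N.obj y := fun x y f =>
    (N.map f).hom ∘ₗ g x - g y ∘ₗ (Q.map f).hom
  obtain ⟨D1, h1, h2, h3⟩ := exists_equivariant_extension i hi e hst D0
    (fun {x y} f q => by
      simp only [D0, LinearMap.sub_apply, LinearMap.comp_apply, map_sub]
      rw [LeftMod.naturality_apply, hg, hg, LeftMod.naturality_apply, sub_self])
    (fun {x y x' y'} f h h' hh hh' => by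
      ext q
      simp only [D0, LinearMap.sub_apply, LinearMap.comp_apply, map_sub, LeftMod.map_comp_apply]
      rw [hg' h hh, hg' h' hh'])
  have h4 : ∀ {x y z : C} (α : x ⟶ y) (h : y ⟶ z), Unfactorisable α → IsIso h →
      D1 (α ≫ h) = (N.map h).hom ∘ₗ D1 α := fun {x y z} α h _ hh => by
    have := h3 α (𝟙 x) h inferInstance hh
    rwa [Category.id_comp, P.map_id, ModuleCat.hom_id, LinearMap.comp_id] at this
  have h5 : ∀ {x y z : C} (h : x ⟶ y) (α : y ⟶ z), Unfactorisable α → IsIso h →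
      D1 (h ≫ α) = D1 α ∘ₗ (P.map h).hom := fun {x y z} h α _ hh => by
    have := h3 α h (𝟙 z) hh inferInstance
    rwa [Category.comp_id, N.map_id, ModuleCat.hom_id, LinearMap.id_comp] at this
  choose D hD using fun ⦃x y : C⦄ (f : x ⟶ y) => ExtDer.exists_of_built (D := D1) (hB f)
  have huniq : ∀ {x y : C} {f : x ⟶ y} {d : P.obj x →ₗ[k] N.obj y}, ExtDer D1 f d → D f = d :=
    fun {x y f d} h => ExtDer.unique h4 hU h5 (hD f) h
  obtain ⟨δ, hδ⟩ := exists_inner_of_projective hP D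
    (fun x => huniq (.iso _ inferInstance)) (fun f f' => huniq ((hD f).leibniz h4 (hD f')))
  have heD : ∀ {x y : C} (f : x ⟶ y) p, (e.app y).hom (D f p) = 0 := fun f p =>
    (hD f).comp_eq_zero e h2 p
  -- `δ` is natural up to `D`, and `e` kills `D`.
  let ε : P ⟶ N' := LeftMod.homMk (fun c => (e.app c).hom ∘ₗ δ c) fun {x y} f p => by
    simp only [LinearMap.comp_apply]
    rw [hδ, map_add, heD, add_zero, LeftMod.naturality_apply]
  let η : P ⟶ N := Projective.factorThru ε e
  have hη : ∀ c p, (e.app c).hom ((η.app c).hom p) = (e.app c).hom (δ c p) := fun c p =>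
    congrArg (fun t => (t.app c).hom p) (Projective.factorThru_comp ε e)
  let l : ∀ c, Q.obj c →ₗ[k] N.obj c := fun c =>
    g c + (δ c - (η.app c).hom) ∘ₗ (i.app c).hom
  have hl : ∀ {x y : C} (f : x ⟶ y) (q : Q.obj x),
      l y ((Q.map f).hom q) = (N.map f).hom (l x q) := by
    -- `D` is known to restrict to `D0` on `Q` only at unfactorisable morphisms, so naturality is
    -- checked on generators and propagated by induction.
    intro x y f
    induction hB f with
    | iso f hf =>
      intro q
      simp only [l, LinearMap.add_apply, LinearMap.sub_apply, LinearMap.comp_apply, map_add,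
        map_sub]
      rw [hg' f hf, LeftMod.naturality_apply, hδ, LeftMod.naturality_apply,
        huniq (.iso f hf), LinearMap.zero_apply, add_zero]
    | snoc f α hα _ ih =>
      intro q
      rw [LeftMod.map_comp_apply, LeftMod.map_comp_apply, ← ih]
      generalize (Q.map f).hom q = q'
      simp only [l, LinearMap.add_apply, LinearMap.sub_apply, LinearMap.comp_apply, map_add,
        map_sub]
      rw [LeftMod.naturality_apply, hδ, LeftMod.naturality_apply,
        huniq (.of_unfactorisable α hα), h1 α hα]
      simp only [D0, LinearMap.sub_apply, LinearMap.comp_apply]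
      abel
  refine ⟨LeftMod.homMk l hl, ?_⟩
  ext c q
  change (e.app c).hom (l c q) = (φ.app c).hom q
  simp only [l, LinearMap.add_apply, LinearMap.sub_apply, LinearMap.comp_apply, map_add, map_sub]
  rw [hη, sub_self, add_zero, hg]

end Hereditary

/-! ### Chains, ladders and passage to the opposite category. -/

open Opposite

section

variable {C : Type u} [SmallCategory C]

theorem Chain.built {x y : C} (p : Chain x y) : Built C p.comp := by
  induction p with
  | nil => exact .iso _ (inferInstanceAs (IsIso (𝟙 x)))
  | snoc p α hα ih => exact .snoc _ α hα ih

theorem FFP.built (h : FFP C) {x y : C} (f : x ⟶ y) : Built C f := by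
  by_cases hf : IsIso f
  · exact .iso f hf
  · obtain ⟨p, rfl⟩ := h f hf
    exact p.built

theorem unfactorisable_op {x y : C} {f : x ⟶ y} (hf : Unfactorisable f) :
    Unfactorisable f.op := by
  refine ⟨fun h => hf.1 ((isIso_op_iff f).1 h), ?_⟩
  rintro ⟨z, g, h, hg, hh, hgh⟩
  exact hf.2 ⟨z.unop, h.unop, g.unop, fun h' => hh ((isIso_unop_iff h).1 h'),
    fun h' => hg ((isIso_unop_iff g).1 h'), Quiver.Hom.op_inj hgh⟩

theorem unfactorisable_unop {x y : Cᵒᵖ} {f : x ⟶ y} (hf : Unfactorisable f) :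
    Unfactorisable f.unop := by
  refine ⟨fun h => hf.1 ((isIso_unop_iff f).1 h), ?_⟩
  rintro ⟨z, g, h, hg, hh, hgh⟩
  exact hf.2 ⟨op z, h.op, g.op, fun h' => hh ((isIso_op_iff h).1 h'),
    fun h' => hg ((isIso_op_iff g).1 h'), Quiver.Hom.unop_inj hgh⟩

theorem Chain.built_op {x y : C} (p : Chain x y) :
    ∀ {z : C} (g : y ⟶ z), Built Cᵒᵖ g.op → Built Cᵒᵖ (p.comp ≫ g).op := by
  induction p with
  | nil =>
    intro z g hg
    rwa [show (Chain.nil : Chain x x).comp = 𝟙 x from rfl, Category.id_comp]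
  | snoc p α hα ih =>
    intro z g hg
    rw [show (p.snoc α hα).comp = p.comp ≫ α from rfl, Category.assoc]
    exact ih _ (Built.snoc g.op α.op (unfactorisable_op hα) hg)

theorem FFP.built_op (h : FFP C) {x y : Cᵒᵖ} (f : x ⟶ y) : Built Cᵒᵖ f := by
  by_cases hf : IsIso f
  · exact .iso f hf
  · obtain ⟨p, hp⟩ := h f.unop fun h' => hf ((isIso_unop_iff f).1 h')
    have := p.built_op (𝟙 _) (.iso _ inferInstance)
    rwa [Category.comp_id, hp] at this

theorem Ladder.comp_eq {x y y' : C} {p : Chain x y} {p' : Chain x y'} {h : y ≅ y'}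
    (l : Ladder p p' h) : p.comp ≫ h.hom = p'.comp := by
  induction l with
  | nil => exact Category.comp_id _
  | snoc α hα α' hα' h' l comm ih =>
    change (_ ≫ α) ≫ h'.hom = _ ≫ α'
    rw [← ih, Category.assoc, Category.assoc, comm]

variable [EICategory C]

theorem Unfactorisable.isIso_iff_of_comp_eq {x y z z' : C} {u : x ⟶ z} {α : z ⟶ y} {u' : x ⟶ z'}
    {α' : z' ⟶ y} (hα : Unfactorisable α) (hα' : Unfactorisable α') (h : u ≫ α = u' ≫ α')
    (hu : IsIso u) : IsIso u' := by
  by_contra hu'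
  exact (hα.iso_comp u).2 ⟨_, u', α', hu', hα'.1, h.symm⟩

/-- Chains for `u` and `u'` are prolonged by `α` and `α'`; the rung just below the end of the
resulting ladder is the isomorphism sought. Invertible `u` is treated apart, since factorisations
into chains are only given for non-invertible morphisms. -/
theorem UFP.uniqueLastFactor (hF : FFP C) (hU : UFP C) : UniqueLastFactor C := by
  intro x y z z' u α u' α' hα hα' h
  by_cases hu : IsIso u
  · have hu' := hα.isIso_iff_of_comp_eq hα' h hu
    exact ⟨asIso (inv u ≫ u'), by simp, by simp [← h]⟩
  · have hu' : ¬ IsIso u' := fun hu' => hu (hα'.isIso_iff_of_comp_eq hα h.symm hu')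
    obtain ⟨p, rfl⟩ := hF u hu
    obtain ⟨p', rfl⟩ := hF u' hu'
    cases hU (p.snoc α hα) (p'.snoc α' hα') h with
    | @snoc _ _ _ _ _ _ t _ _ _ _ _ l comm =>
      exact ⟨t, l.comp_eq, comm.trans (Category.comp_id α)⟩

/-- Last factors are peeled off one at a time. The end isomorphism must be arbitrary for the
induction, and is absorbed into the last factor of the first chain. -/
theorem UniqueLastFactor.ladder (hU : UniqueLastFactor C) {x y : C} (p : Chain x y) :
    ∀ {y' : C} (p' : Chain x y') (h : y ≅ y'), p.comp ≫ h.hom = p'.comp → Ladder p p' h := by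
  induction p with
  | nil =>
    intro y' p' h hp
    cases p' with
    | nil =>
      obtain rfl : h = Iso.refl x := Iso.ext ((Category.id_comp _).symm.trans hp)
      exact .nil
    | snoc p' α hα =>
      refine (hα.1 (isIso_right_of_comp p'.comp α ?_)).elim
      have h1 : h.hom = p'.comp ≫ α := (Category.id_comp _).symm.trans hp
      rw [← h1]
      infer_instance
  | snoc p α hα ih =>
    intro y' p' h hp
    have hp' : p.comp ≫ α ≫ h.hom = p'.comp := (Category.assoc _ _ _).symm.trans hp
    cases p' with
    | nil =>
      refine (hα.1 (isIso_left_of_comp α h.hom (isIso_right_of_comp p.comp _ ?_))).elim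
      rw [hp']
      exact inferInstanceAs (IsIso (𝟙 x))
    | snoc p' α' hα' =>
      obtain ⟨t, ht, ht'⟩ := hU p.comp (α ≫ h.hom) p'.comp α' (hα.comp_iso _) hα' hp'
      exact .snoc α hα α' hα' h (ih p' t ht) ht'

theorem UniqueLastFactor.ufp (hU : UniqueLastFactor C) : UFP C := fun p p' h =>
  hU.ladder p p' (Iso.refl _) ((Category.comp_id _).trans h)

/-- The mirror image of `UniqueLastFactor`, needed for `Cᵒᵖ`. By induction on the tail: last factors
are matched by `hU`, and the resulting isomorphism is moved into the shorter tail. -/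
theorem UniqueLastFactor.exists_iso_first (hB : ∀ {x y : C} (f : x ⟶ y), Built C f)
    (hU : UniqueLastFactor C) {x y z : C} (g : z ⟶ y) :
    ∀ {z' : C} (α : x ⟶ z) (α' : x ⟶ z') (g' : z' ⟶ y), Unfactorisable α → Unfactorisable α' →
      α ≫ g = α' ≫ g' → ∃ s : z ≅ z', α ≫ s.hom = α' ∧ s.hom ≫ g' = g := by
  induction hB g with
  | iso g hg =>
    intro z' α α' g' hα hα' h
    have hg' : IsIso g' := by
      by_contra hg'
      exact (hα.comp_iso g).2 ⟨_, α', g', hα'.1, hg', h.symm⟩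
    exact ⟨asIso (g ≫ inv g'), by simp [reassoc_of% h], by simp⟩
  | snoc u β hβ _ ih =>
    intro z' α α' g' hα hα' h
    cases hB g' with
    | iso _ hg' =>
      exact ((hα'.comp_iso g').2 ⟨_, α, u ≫ β, hα.1, not_isIso_comp_right u hβ.1, h⟩).elim
    | snoc u' β' hβ' _ =>
      obtain ⟨t, ht, rfl⟩ := hU (α ≫ u) β (α' ≫ u') β' hβ hβ' (by simpa using h)
      obtain ⟨s, hs, hs'⟩ := ih α α' (u' ≫ t.inv) hα hα' (by
        rw [← Category.assoc α', ← ht]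
        simp)
      refine ⟨s, hs, ?_⟩
      rw [← hs']
      simp

instance : EICategory Cᵒᵖ where
  isIso_of_endo f := (isIso_unop_iff f).1 (isIso_of_endo f.unop)

theorem UniqueLastFactor.op (hB : ∀ {x y : C} (f : x ⟶ y), Built C f)
    (hU : UniqueLastFactor C) : UniqueLastFactor Cᵒᵖ := by
  intro x y z z' u α u' α' hα hα' h
  obtain ⟨s, hs, hs'⟩ := hU.exists_iso_first hB u.unop α.unop α'.unop u'.unop
    (unfactorisable_unop hα) (unfactorisable_unop hα') (Quiver.Hom.op_inj h)
  refine ⟨s.symm.op, ?_, ?_⟩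
  · apply Quiver.Hom.unop_inj
    change s.inv ≫ u.unop = u'.unop
    rw [← hs', s.inv_hom_id_assoc]
  · apply Quiver.Hom.unop_inj
    change α'.unop ≫ s.inv = α.unop
    rw [← hs, Category.assoc, s.hom_inv_id, Category.comp_id]

/-- Taking inverses identifies the automorphisms of an object with those in the opposite
category. -/
noncomputable def endOpEquiv (c : C) : End c ≃* End (op c) where
  toFun g := (show c ⟶ c from (g⁻¹ : End c)).op
  invFun g := ((show End c from g.unop)⁻¹ : End c)
  left_inv g := inv_inv g
  right_inv g := congrArg (fun t : End c => (show c ⟶ c from t).op)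
    (inv_inv (show End c from g.unop))
  map_mul' a b := congrArg (fun t : End c => (show c ⟶ c from t).op) (mul_inv_rev a b)

variable {k : Type u} [CommRing k]

theorem stabilizer_op_unitFinite
    (hst : ∀ {c d : C} (f : c ⟶ d), ¬ IsIso f →
      UnitFinite k (MulAction.stabilizer (End d × (End c)ᵐᵒᵖ) f))
    {c d : Cᵒᵖ} (f : c ⟶ d) (hf : ¬ IsIso f) :
    UnitFinite k (MulAction.stabilizer (End d × (End c)ᵐᵒᵖ) f) := by
  refine (hst f.unop fun h => hf ((isIso_unop_iff f).1 h)).of_injective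
    { toFun g := ⟨((show End c.unop from g.1.2.unop.unop),
        MulOpposite.op (show End d.unop from g.1.1.unop)),
        (Category.assoc _ _ _).symm.trans (congrArg Quiver.Hom.unop g.2)⟩
      map_one' := rfl
      map_mul' a b := rfl } fun a b hab => ?_
  have h1 : a.1.2.unop.unop = b.1.2.unop.unop := congrArg (fun t => t.1.1) hab
  have h2 : a.1.1.unop = b.1.1.unop := congrArg (fun t => t.1.2.unop) hab
  exact Subtype.ext (Prod.ext (Quiver.Hom.unop_inj h2)
    (MulOpposite.unop_injective (Quiver.Hom.unop_inj h1)))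

theorem hereditary_rep_op {c : C} (h : Hereditary (Rep.{u} k (End c))) :
    Hereditary (Rep.{u} k (End (op c))) := by
  rw [← hereditaryRing_monoidAlgebra_iff] at h ⊢
  exact Hereditary.of_equivalence (ModuleCat.restrictScalarsEquivalenceOfRingEquiv
    (MonoidAlgebra.domCongr k k (endOpEquiv c)).toRingEquiv) h

/-- A stabilising pair is determined by its two components, which lie in the target stabilisers of
`f` and of `f.op`; left modules control the first and right modules the second. -/
theorem stabilizer_unitFinite [Nontrivial k] (hL : Hereditary (LeftMod k C))
    (hR : Hereditary (RightMod k C)) {c d : C} (f : c ⟶ d) (hf : ¬ IsIso f) :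
    UnitFinite k (MulAction.stabilizer (End d × (End c)ᵐᵒᵖ) f) := by
  have h1 := hL.unitFinite_targetStabiliser f hf
  have h2 := Hereditary.unitFinite_targetStabiliser (C := Cᵒᵖ) hR f.op
    fun h => hf ((isIso_op_iff f).1 h)
  have hmem : ∀ g : MulAction.stabilizer (End d × (End c)ᵐᵒᵖ) f,
      (show c ⟶ c from g.1.2.unop) ≫ f ≫ (show d ⟶ d from g.1.1) = f := fun g => g.2
  refine (h1.prod h2).of_injective
    { toFun g := (⟨g.1.1, by
          have := isIso_of_endo (show c ⟶ c from g.1.2.unop)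
          exact ⟨inv (show c ⟶ c from g.1.2.unop), by rw [IsIso.eq_inv_comp, hmem]⟩⟩,
        ⟨(show c ⟶ c from g.1.2.unop).op, by
          have := isIso_of_endo (show d ⟶ d from g.1.1)
          refine ⟨(inv (show d ⟶ d from g.1.1)).op, Quiver.Hom.unop_inj ?_⟩
          change (show c ⟶ c from g.1.2.unop) ≫ f = f ≫ inv (show d ⟶ d from g.1.1)
          rw [IsIso.eq_comp_inv, Category.assoc, hmem]⟩)
      map_one' := rfl
      map_mul' a b := rfl } fun a b hab => ?_
  have h3 : a.1.1 = b.1.1 := congrArg (fun t => t.1.1) hab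
  have h4 : a.1.2.unop = b.1.2.unop := congrArg (fun t => t.2.1.unop) hab
  exact Subtype.ext (Prod.ext h3 (MulOpposite.unop_injective h4))

/-- Left modules give `t` matching `α` with `α'`, but `t` need not carry `u` to `u'`. Since `u ≫
t.hom` and `u'` agree after composing with `α'`, right modules give an automorphism fixing `α'` that
corrects this. -/
theorem uniqueLastFactor_of_hereditary [Nontrivial k] (hL : Hereditary (LeftMod k C))
    (hR : Hereditary (RightMod k C)) : UniqueLastFactor C := by
  intro x y z z' u α u' α' hα hα' h
  obtain ⟨t, rfl⟩ := hL.exists_iso_of_comp_eq u u' α α' hα hα' h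
  obtain ⟨s, hs, hs'⟩ := Hereditary.exists_aut_of_comp_eq (C := Cᵒᵖ) hR α'.op (u ≫ t.hom).op u'.op
    (Quiver.Hom.unop_inj (by simpa using h))
  have h1 : s.unop ≫ α' = α' := congrArg Quiver.Hom.unop hs
  have h2 : (u ≫ t.hom) ≫ s.unop = u' := congrArg Quiver.Hom.unop hs'
  have := isIso_of_endo s.unop
  refine ⟨t ≪≫ asIso s.unop, ?_, ?_⟩
  · simpa using h2
  · simp [h1]

end

end EICat

theorem corollaryD (k : Type u) [CommRing k] [Nontrivial k] [IsSemisimpleRing k]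
    (C : Type u) [SmallCategory C] [EICat.EICategory C] (hFFP : EICat.FFP C) :
    (EICat.Hereditary (EICat.LeftMod k C) ∧ EICat.Hereditary (EICat.RightMod k C)) ↔
      (∀ c : C, EICat.HereditaryRing (MonoidAlgebra k (End c))) ∧
      EICat.UFP C ∧
      (∀ c d : C, EICat.StrictlyBelow c d →
        ∀ H : Subgroup (End d × (End c)ᵐᵒᵖ), EICat.IsBisetStabiliser H →
          EICat.UnitFinite k H) := by
  constructor
  · rintro ⟨hL, hR⟩
    refine ⟨fun c => (EICat.hereditaryRing_monoidAlgebra_iff k (End c)).2 (hL.hereditary_rep c),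
      EICat.UniqueLastFactor.ufp (EICat.uniqueLastFactor_of_hereditary hL hR), ?_⟩
    rintro c d hcd _ ⟨f, rfl⟩
    exact EICat.stabilizer_unitFinite hL hR f (hcd.not_isIso f)
  · rintro ⟨hG, hU, hst⟩
    have hst' : ∀ {c d : C} (f : c ⟶ d), ¬ IsIso f →
        EICat.UnitFinite k (MulAction.stabilizer (End d × (End c)ᵐᵒᵖ) f) := fun {c d} f hf =>
      hst c d (EICat.strictlyBelow_of_not_isIso f hf) _ ⟨f, rfl⟩
    have hG' : ∀ c : C, EICat.Hereditary (Rep.{u} k (End c)) := fun c => (EICat.hereditaryRing_monoidAlgebra_iff k (End c)).1 (hG c)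
    have hU' : EICat.UniqueLastFactor C := EICat.UFP.uniqueLastFactor hFFP hU
    exact ⟨EICat.hereditary_leftMod (fun f => EICat.FFP.built hFFP f) hU' hG' hst',
      EICat.hereditary_leftMod (C := Cᵒᵖ) (fun f => EICat.FFP.built_op hFFP f)
        (EICat.UniqueLastFactor.op (fun f => EICat.FFP.built hFFP f) hU') (fun c => EICat.hereditary_rep_op (hG' c.unop))
        (EICat.stabilizer_op_unitFinite hst')⟩
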